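/- Let $h$ be a whole-plane Gaussian free field, normalized so that its average over the unit circle $\partial\mathbb D$ is zero, and let $h_\varepsilon(z)$ be its average over the circle of radius $\varepsilon$ centered at $z$. For $\varepsilon>0$ let $\mathbb S^\varepsilon=(\varepsilon\mathbb Z^2)\cap[0,1]^2$ with its nearest-neighbor graph structure, and let $\partial_{\mathrm L}\mathbb S^\varepsilon$ (resp. $\partial_{\mathrm R}\mathbb S^\varepsilon$) be the set of vertices of $\mathbb S^\varepsilon$ whose left (resp. right) neighbor in $\varepsilon\mathbb Z^2$ is not in $\mathbb S^\varepsilon$. For $\xi\ge 0$ and a lattice path $P=(P(0),\dots,P(N))$ in $\mathbb S^\varepsilon$ put $$L_h^{\xi,\varepsilon}(P)=\sum_{j=0}^N\varepsilon\, e^{\xi h_\varepsilon(P(j))},$$ let $\#P$ be the number of vertices of $P$, let $D_h^{\xi,\varepsilon}(\partial_{\mathrm L}\mathbb S^\varepsilon,\partial_{\mathrm R}\mathbb S^\varepsilon)$ be the infimum of $L_h^{\xi,\varepsilon}(P)$ over all lattice paths $P$ in $\mathbb S^\varepsilon$ from $\partial_{\mathrm L}\mathbb S^\varepsilon$ to $\partial_{\mathrm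 R}\mathbb S^\varepsilon$, and let $P_h^{\xi,\varepsilon}$ be a path attaining this infimum (for $\xi>0$ it is a.s. unique). Define $$\lambda(\xi)=\sup\Bigl\{\alpha\in\mathbb R:\liminf_{\varepsilon\to0}\mathbb P\bigl[D_h^{\xi,\varepsilon}(\partial_{\mathrm L}\mathbb S^\varepsilon,\partial_{\mathrm R}\mathbb S^\varepsilon)\le\varepsilon^{\alpha}\bigr]=1\Bigr\},\qquad g(\xi)=\inf\Bigl\{\alpha>0:\liminf_{\varepsilon\to0}\mathbb P\bigl[\#P_h^{\xi,\varepsilon}\le\varepsilon^{-\alpha}\bigr]=1\Bigr\}.$$ Then for each $\xi>0$ and each $\zeta>0$, it holds with probability tending to $1$ as $\varepsilon\to0$ that each simple path $P$ in $\mathbb S^\varepsilon$ with $L_h^{\xi,\varepsilon}(P)\le\varepsilon^{\lambda(\xi)-\zeta}$ satisfies $$\#P\le\varepsilon^{\lambda(\xi)-\xi\left(\sqrt{2+2\lambda(\xi)+\xi^2}-\xi\right)-1-\zeta}.$$ In particular, for each $\xi>0$, $$g(\xi)\le 1-\lambda(\xi)+\xi\left(\sqrt{2+2\lambda(\xi)+\xi^2}-\xi\right).$$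 -/

import Mathlib

open MeasureTheory ProbabilityTheory Filter Topology Real

noncomputable section

namespace LFPP

/-! ### The whole-plane Gaussian free field and its circle averages -/

/-- Covariance kernel of the whole-plane Gaussian free field, normalized so that its average over
the unit circle `∂𝔻` is zero:
`G(x, y) = log (max(|x|, 1) * max(|y|, 1) / |x - y|)`. -/
def wholePlaneKernel (x y : ℂ) : ℝ := log⁺ ‖x‖ + log⁺ ‖y‖ - Real.log ‖x - y‖

/-- A compactly supported finite positive Borel measure on the plane of finite logarithmic energy:
the measures against which the Gaussian free field can be tested. (Measures with an atom have
infinite logarithmic energy; they are excluded separately because `Real.log 0 = 0`.) -/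
structure FiniteLogEnergy (μ : Measure ℂ) : Prop where
  finite : IsFiniteMeasure μ
  compactSupport : ∃ K : Set ℂ, IsCompact K ∧ μ Kᶜ = 0
  noAtoms : ∀ x : ℂ, μ {x} = 0
  integrable : Integrable (fun p : ℂ × ℂ => Real.log ‖p.1 - p.2‖) (μ.prod μ)

/-- `h` is a whole-plane Gaussian free field under `P`, normalized so that its average over `∂𝔻`
is zero. The random variable `h μ` is the pairing `(h, μ)`; the field is the centered Gaussian
process indexed by the measures of finite logarithmic energy whose covariance is
`Cov((h, μ), (h, ν)) = ∬ G(x, y) μ(dx) ν(dy)`.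
The values of `h` at other measures are irrelevant. -/
structure IsWholePlaneGFF {Ω : Type*} [MeasurableSpace Ω] (h : Measure ℂ → Ω → ℝ)
    (P : Measure Ω) : Prop where
  gaussian : IsGaussianProcess (fun μ : {μ : Measure ℂ // FiniteLogEnergy μ} => h μ) P
  centered : ∀ μ : Measure ℂ, FiniteLogEnergy μ → ∫ ω, h μ ω ∂P = 0
  covariance : ∀ μ ν : Measure ℂ, FiniteLogEnergy μ → FiniteLogEnergy ν →
    cov[h μ, h ν; P] = ∫ x, ∫ y, wholePlaneKernel x y ∂ν ∂μ

/-- The uniform probability measure on the circle of radius `r` centered at `z`. -/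
def circleMeasure (z : ℂ) (r : ℝ) : Measure ℂ :=
  (ENNReal.ofReal (2 * π))⁻¹ • (volume.restrict (Set.Ioc 0 (2 * π))).map (circleMap z r)

/-- The circle average `h_ε(z)`. -/
def circleAvg {Ω : Type*} (h : Measure ℂ → Ω → ℝ) (ε : ℝ) (z : ℂ) (ω : Ω) : ℝ :=
  h (circleMeasure z ε) ω

lemma integral_circleMeasure (z : ℂ) (r : ℝ) {f : ℂ → ℝ} (hf : Measurable f) :
    ∫ x, f x ∂(circleMeasure z r) = circleAverage f z r := by
  have h2 : (0 : ℝ) ≤ 2 * π := by positivity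
  rw [circleMeasure, integral_smul_measure,
    integral_map (continuous_circleMap z r).measurable.aemeasurable hf.aestronglyMeasurable,
    circleAverage_def, intervalIntegral.integral_of_le h2, ENNReal.toReal_inv,
    ENNReal.toReal_ofReal h2]

lemma integrable_circleMeasure (z : ℂ) (r : ℝ) {f : ℂ → ℝ} (hf : Measurable f)
    (hc : CircleIntegrable f z r) : Integrable f (circleMeasure z r) := by
  have h2 : (0 : ℝ) ≤ 2 * π := by positivity
  refine Integrable.smul_measure ?_ (by simp [pi_pos])
  rw [integrable_map_measure hf.aestronglyMeasurable
    (continuous_circleMap z r).measurable.aemeasurable]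
  exact (intervalIntegrable_iff_integrableOn_Ioc_of_le h2).1 hc

instance isProbabilityMeasure_circleMeasure (z : ℂ) (r : ℝ) :
    IsProbabilityMeasure (circleMeasure z r) := by
  have h2 : (0 : ℝ) < 2 * π := by positivity
  constructor
  rw [circleMeasure, Measure.smul_apply,
    Measure.map_apply (continuous_circleMap z r).measurable MeasurableSet.univ]
  simp only [Set.preimage_univ, Measure.restrict_apply_univ, Real.volume_Ioc, sub_zero, smul_eq_mul]
  exact ENNReal.inv_mul_cancel (by simpa using pi_pos) ENNReal.ofReal_ne_top

lemma ae_circleMeasure (z : ℂ) (r : ℝ) :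
    ∀ᵐ x ∂(circleMeasure z r), x ∈ Metric.sphere z |r| := by
  refine Measure.ae_smul_measure ?_ _
  exact (ae_map_iff (p := fun x => x ∈ Metric.sphere z |r|)
    (continuous_circleMap z r).measurable.aemeasurable
    Metric.isClosed_sphere.measurableSet).2
      (Eventually.of_forall fun θ => circleMap_mem_sphere' z r θ)

/-- Circles of positive radius have finite logarithmic energy, so that the circle averages of the
free field are genuine values of it. -/
lemma finiteLogEnergy_circleMeasure (z : ℂ) {r : ℝ} (hr : 0 < r) :
    FiniteLogEnergy (circleMeasure z r) := by
  have hmeas : ∀ a : ℂ, Measurable fun y : ℂ => Real.log ‖y - a‖ := fun a =>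
    Real.measurable_log.comp (measurable_id.sub_const a).norm
  have hmeas2 : Measurable fun p : ℂ × ℂ => Real.log ‖p.1 - p.2‖ :=
    Real.measurable_log.comp (measurable_fst.sub measurable_snd).norm
  have hint : ∀ a : ℂ, Integrable (fun y : ℂ => Real.log ‖y - a‖) (circleMeasure z r) := fun a =>
    integrable_circleMeasure z r (hmeas a) (circleIntegrable_log_norm_sub_const r)
  refine ⟨inferInstance, ⟨Metric.sphere z |r|, isCompact_sphere z |r|, ae_circleMeasure z r⟩, ?_, ?_⟩
  · intro x
    have h2 : (volume.restrict (Set.Ioc 0 (2 * π))) (circleMap z r ⁻¹' {x}) = 0 := by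
      refine le_antisymm (le_trans (Measure.restrict_apply_le _ _) ?_) bot_le
      exact ((Set.countable_singleton x).preimage_circleMap z hr.ne').measure_zero volume |>.le
    rw [circleMeasure, Measure.smul_apply, Measure.map_apply
      (continuous_circleMap z r).measurable (measurableSet_singleton x), h2, smul_zero]
  · have hint' : ∀ a : ℂ, Integrable (fun y : ℂ => Real.log ‖a - y‖) (circleMeasure z r) := by
      intro a
      simpa only [norm_sub_rev] using hint a
    rw [integrable_prod_iff hmeas2.aestronglyMeasurable]
    refine ⟨Eventually.of_forall hint', ?_⟩
    have hm : AEStronglyMeasurable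
        (fun x : ℂ => ∫ y, ‖Real.log ‖x - y‖‖ ∂(circleMeasure z r)) (circleMeasure z r) :=
      (hmeas2.norm.aestronglyMeasurable (μ := (circleMeasure z r).prod
        (circleMeasure z r))).integral_prod_right'
    refine Integrable.of_bound hm (2 * log⁺ (2 * r) - Real.log r) ?_
    filter_upwards [ae_circleMeasure z r] with x hx
    rw [Real.norm_of_nonneg (integral_nonneg fun y => norm_nonneg _)]
    have hlog : ∫ y, Real.log ‖x - y‖ ∂(circleMeasure z r) = Real.log r := by
      have e := integral_circleMeasure z r (hmeas x)
      rw [circleAverage_log_norm_sub_const_of_mem_closedBall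
        (Metric.sphere_subset_closedBall hx)] at e
      simpa only [norm_sub_rev] using e
    calc ∫ y, ‖Real.log ‖x - y‖‖ ∂(circleMeasure z r)
        ≤ ∫ y, (2 * log⁺ (2 * r) - Real.log ‖x - y‖) ∂(circleMeasure z r) := by
          refine integral_mono_ae (hint' x).norm ((integrable_const _).sub (hint' x)) ?_
          filter_upwards [ae_circleMeasure z r] with y hy
          have hd : ‖x - y‖ ≤ 2 * r := by
            rw [← dist_eq_norm]
            have h1 := Metric.mem_sphere.1 hx
            have h2 := Metric.mem_sphere'.1 hy
            rw [abs_of_pos hr] at h1 h2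
            linarith [dist_triangle x z y]
          have h3 : log⁺ ‖x - y‖ ≤ log⁺ (2 * r) := Real.posLog_le_posLog (norm_nonneg _) hd
          have h4 : Real.log ‖x - y‖ ≤ log⁺ ‖x - y‖ := by
            rw [Real.posLog]; exact le_max_right _ _
          have h5 : (0 : ℝ) ≤ log⁺ (2 * r) := Real.posLog_nonneg
          rw [Real.norm_eq_abs]
          exact abs_le'.2 ⟨by linarith, by linarith⟩ |>.trans le_rfl
      _ = 2 * log⁺ (2 * r) - Real.log r := by
          rw [integral_sub (integrable_const _) (hint' x), hlog]
          simp

/-- The field is normalized: its average over the unit circle has variance zero. -/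
lemma kernel_unitCircle :
    ∫ x, ∫ y, wholePlaneKernel x y ∂(circleMeasure 0 1) ∂(circleMeasure 0 1) = 0 := by
  refine integral_eq_zero_of_ae ?_
  filter_upwards [ae_circleMeasure 0 1] with x hx
  have hmeas : Measurable fun y : ℂ => Real.log ‖y - x‖ :=
    Real.measurable_log.comp (measurable_id.sub_const x).norm
  have e := integral_circleMeasure 0 1 hmeas
  rw [circleAverage_log_norm_sub_const_of_mem_closedBall (Metric.sphere_subset_closedBall hx),
    Real.log_one] at e
  have hx1 : ‖x‖ = 1 := by simpa using hx
  have : ∫ y, wholePlaneKernel x y ∂(circleMeasure 0 1)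
      = ∫ y, -Real.log ‖y - x‖ ∂(circleMeasure 0 1) := by
    refine integral_congr_ae ?_
    filter_upwards [ae_circleMeasure 0 1] with y hy
    have hy1 : ‖y‖ = 1 := by simpa using hy
    simp [wholePlaneKernel, hx1, hy1, Real.posLog, norm_sub_rev x y]
  rw [this, integral_neg, e]
  simp

/-! ### Liouville first passage percolation -/

/-- The vertex set of `𝕊^ε = (ε ℤ²) ∩ [0,1]²`, a vertex being recorded by its integer
coordinates. -/
def Box (ε : ℝ) : Set (ℤ × ℤ) :=
  {v | ε * v.1 ∈ Set.Icc (0 : ℝ) 1 ∧ ε * v.2 ∈ Set.Icc (0 : ℝ) 1}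

/-- The point of the plane with integer coordinates `v` in the lattice `ε ℤ²`. -/
def toPlane (ε : ℝ) (v : ℤ × ℤ) : ℂ := ⟨ε * v.1, ε * v.2⟩

/-- The nearest-neighbor graph structure on `𝕊^ε`. -/
def boxGraph (ε : ℝ) : SimpleGraph (Box ε) where
  Adj v w := |v.1.1 - w.1.1| + |v.1.2 - w.1.2| = 1
  symm := ⟨fun v w hvw => by simpa only [abs_sub_comm] using hvw⟩
  loopless := ⟨fun v hv => by simp at hv⟩

/-- The vertices of `𝕊^ε` whose left neighbor in `ε ℤ²` is not in `𝕊^ε`. -/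
def leftBoundary (ε : ℝ) : Set (Box ε) := {v | (v.1.1 - 1, v.1.2) ∉ Box ε}

/-- The vertices of `𝕊^ε` whose right neighbor in `ε ℤ²` is not in `𝕊^ε`. -/
def rightBoundary (ε : ℝ) : Set (Box ε) := {v | (v.1.1 + 1, v.1.2) ∉ Box ε}

/-- The number `#P` of vertices of a path. -/
def numVertices {ε : ℝ} {z w : Box ε} (p : (boxGraph ε).Walk z w) : ℕ := p.support.length

/-- The LFPP length `∑ⱼ ε exp(ξ h_ε(P(j)))` of a lattice path in `𝕊^ε`. -/
def lfppLength {Ω : Type*} (h : Measure ℂ → Ω → ℝ) (ξ ε : ℝ) (ω : Ω) {z w : Box ε}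
    (p : (boxGraph ε).Walk z w) : ℝ :=
  (p.support.map fun v => ε * Real.exp (ξ * circleAvg h ε (toPlane ε v) ω)).sum

/-- The LFPP distance between two vertices of `𝕊^ε`. -/
def lfppDist {Ω : Type*} (h : Measure ℂ → Ω → ℝ) (ξ ε : ℝ) (ω : Ω) (z w : Box ε) : ℝ :=
  ⨅ p : (boxGraph ε).Walk z w, lfppLength h ξ ε ω p

/-- The LFPP distance between the left and right boundaries of `𝕊^ε`. -/
def crossingDist {Ω : Type*} (h : Measure ℂ → Ω → ℝ) (ξ ε : ℝ) (ω : Ω) : ℝ :=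
  ⨅ (z : leftBoundary ε) (w : rightBoundary ε), lfppDist h ξ ε ω z w

/-- The distance exponent `λ(ξ)`. -/
def distExponent {Ω : Type*} [MeasurableSpace Ω] (h : Measure ℂ → Ω → ℝ) (P : Measure Ω)
    (ξ : ℝ) : ℝ :=
  sSup {α : ℝ | liminf (fun ε : ℝ => P {ω | crossingDist h ξ ε ω ≤ ε ^ α}) (𝓝[>] 0) = 1}

/-- `p` is a left-right geodesic: a path from the left to the right boundary of `𝕊^ε` of minimal
LFPP length. (For `ξ > 0` there is almost surely exactly one.) -/
def IsCrossingGeodesic {Ω : Type*} (h : Measure ℂ → Ω → ℝ) (ξ ε : ℝ) (ω : Ω) {z w : Box ε}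
    (p : (boxGraph ε).Walk z w) : Prop :=
  z ∈ leftBoundary ε ∧ w ∈ rightBoundary ε ∧ lfppLength h ξ ε ω p = crossingDist h ξ ε ω

/-- The geodesic dimension `g(ξ)`. The event says that the left-right geodesic has at most
`ε ^ (-α)` vertices. -/
def geodesicDim {Ω : Type*} [MeasurableSpace Ω] (h : Measure ℂ → Ω → ℝ) (P : Measure Ω)
    (ξ : ℝ) : ℝ :=
  sInf {α : ℝ | 0 < α ∧
    liminf (fun ε : ℝ => P {ω | ∀ (z w : Box ε) (p : (boxGraph ε).Walk z w),
      IsCrossingGeodesic h ξ ε ω p → (numVertices p : ℝ) ≤ ε ^ (-α)}) (𝓝[>] 0) = 1}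

end LFPP

end

/-! Write `L = log (1/ε)` and `l = λ(ξ)`. A circle average on the box is a centered Gaussian of
variance about `L`, so by a first moment bound at most about `ε^(a²/2 - 2)` vertices have field
value below `-a L`. Every other vertex of a simple path costs at least `ε^(1 + ξ a)`, so a path of
length `ε^l` has at most `ε^(l - ξ a - 1)` of them. The two counts agree when `a²/2 + ξ a = 1 + l`,
that is, `a = √(2 + 2l + ξ²) - ξ`, and their common value is the claimed bound. See
`numVertices_le`, `measure_lowCount_gt_le` and `tendsto_numVertices_le`.

This needs `a ≥ 0`, which follows from `l ≥ -1`, and that is the harder part: a left-right crossing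
of length at most `ε^(-1 - κ)` must exist with high probability. A path has at most order `ε^(-2)`
vertices of base weight `ε`, so it suffices to cross where the field is at most `δ L`. By the Hex
theorem (`triCross_or_triCross_swap`), either `{h_ε ≤ 0}` has a left-right crossing of the
triangular lattice or `{h_ε ≥ 0}` has a bottom-top one. The law is invariant under a change of sign
combined with the reflection in the diagonal, so the first event has probability at least `1/2`.

To raise `1/2` to a probability tending to one, consider the least level whose sublevel set has a
crossing. This functional is locally a coordinate of the Gaussian vector, so by a Poincaré
inequality (`IsMinimax.integral_sq_sub_le`) its variance is of the order of a single coordinate's,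
namely `L`, while the allowed deviation is `δ L`; Chebyshev's inequality suffices
(`measure_not_crossing_le`). Diagonal steps are then replaced by two lattice steps, at the price of
a neighbour increment of bounded variance (`exists_walk_of_triReach`).

The bound on the geodesic dimension follows because a geodesic is a simple path and its length is at
most `ε^(l - ζ)` with high probability. -/

noncomputable section

namespace LFPP

/-! ### Crossings of coloured squares of the triangular lattice -/

/-- The indicator of the unordered pair `{0, 1}` of labels. -/
def labelEdge (a b : Fin 3) : ZMod 2 := if (a = 0 ∧ b = 1) ∨ (a = 1 ∧ b = 0) then 1 else 0

/-- The parity step of Sperner's lemma: a triangle with at most two labels meets the pair `{0, 1}`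
along an even number of edges. -/
lemma labelEdge_triangle : ∀ a b c : Fin 3, ¬ (a ≠ b ∧ b ≠ c ∧ a ≠ c) →
    labelEdge a b + labelEdge b c + labelEdge a c = 0 := by
  unfold labelEdge; decide

/-- The square is cut along the diagonal `a c`, which lies in both triangles and cancels modulo two.
-/
lemma labelEdge_square {a b c d : Fin 3} (h1 : ¬ (a ≠ b ∧ b ≠ c ∧ a ≠ c))
    (h2 : ¬ (a ≠ d ∧ d ≠ c ∧ a ≠ c)) :
    labelEdge a b + labelEdge b c + labelEdge a d + labelEdge d c = 0 := by
  have e1 := labelEdge_triangle a b c h1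
  have e2 := labelEdge_triangle a d c h2
  have e3 : labelEdge a c + labelEdge a c = 0 := CharTwo.add_self_eq_zero _
  linear_combination e1 + e2 - e3

/-- Each vertical edge shared by two neighbouring squares is counted twice, so only the outline of
the row survives. -/
lemma sum_labelEdge_row (l : ℕ → ℕ → Fin 3) (j N : ℕ)
    (h1 : ∀ i < N, ¬ (l i j ≠ l (i + 1) j ∧ l (i + 1) j ≠ l (i + 1) (j + 1) ∧
      l i j ≠ l (i + 1) (j + 1)))
    (h2 : ∀ i < N, ¬ (l i j ≠ l i (j + 1) ∧ l i (j + 1) ≠ l (i + 1) (j + 1) ∧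
      l i j ≠ l (i + 1) (j + 1))) :
    ∑ i ∈ Finset.range N, labelEdge (l i j) (l (i + 1) j)
      + ∑ i ∈ Finset.range N, labelEdge (l i (j + 1)) (l (i + 1) (j + 1))
      + labelEdge (l 0 j) (l 0 (j + 1)) + labelEdge (l N j) (l N (j + 1)) = 0 := by
  induction N with
  | zero => simpa using CharTwo.add_self_eq_zero _
  | succ N ih =>
    have e := ih (fun i hi => h1 i (by omega)) (fun i hi => h2 i (by omega))
    have e2 := labelEdge_square (h1 N (by omega)) (h2 N (by omega))
    have e3 : labelEdge (l N j) (l N (j + 1)) + labelEdge (l N j) (l N (j + 1)) = 0 :=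
      CharTwo.add_self_eq_zero _
    rw [Finset.sum_range_succ, Finset.sum_range_succ]
    linear_combination e + e2 - e3

/-- In a triangulated rectangle without a triangle carrying all three labels, the number of
boundary edges labelled `{0, 1}` is even. -/
lemma sum_labelEdge_boundary (l : ℕ → ℕ → Fin 3) (N M : ℕ)
    (h1 : ∀ i < N, ∀ j < M, ¬ (l i j ≠ l (i + 1) j ∧ l (i + 1) j ≠ l (i + 1) (j + 1) ∧
      l i j ≠ l (i + 1) (j + 1)))
    (h2 : ∀ i < N, ∀ j < M, ¬ (l i j ≠ l i (j + 1) ∧ l i (j + 1) ≠ l (i + 1) (j + 1) ∧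
      l i j ≠ l (i + 1) (j + 1))) :
    ∑ i ∈ Finset.range N, labelEdge (l i 0) (l (i + 1) 0)
      + ∑ i ∈ Finset.range N, labelEdge (l i M) (l (i + 1) M)
      + ∑ j ∈ Finset.range M, labelEdge (l 0 j) (l 0 (j + 1))
      + ∑ j ∈ Finset.range M, labelEdge (l N j) (l N (j + 1)) = 0 := by
  induction M with
  | zero => simpa using CharTwo.add_self_eq_zero _
  | succ M ih =>
    have e := ih (fun i hi j hj => h1 i hi j (by omega)) (fun i hi j hj => h2 i hi j (by omega))
    have e2 := sum_labelEdge_row l M N (fun i hi => h1 i hi M (by omega))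
      (fun i hi => h2 i hi M (by omega))
    have e3 := CharTwo.add_self_eq_zero
      (∑ i ∈ Finset.range N, labelEdge (l i M) (l (i + 1) M))
    rw [Finset.sum_range_succ _ M, Finset.sum_range_succ _ M]
    linear_combination e + e2 - e3

/-- Adjacency or equality in the triangular lattice, realized as `ℤ²` with diagonals `(1, 1)`. -/
def TriAdj (u v : ℤ × ℤ) : Prop :=
  (-1 ≤ v.1 - u.1 ∧ v.1 - u.1 ≤ 1) ∧ (-1 ≤ v.2 - u.2 ∧ v.2 - u.2 ≤ 1) ∧
    (-1 ≤ (v.1 - u.1) - (v.2 - u.2) ∧ (v.1 - u.1) - (v.2 - u.2) ≤ 1)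

/-- `v` can be reached from `u` inside `S` along the triangular lattice. -/
def TriReach (S : Set (ℤ × ℤ)) : ℤ × ℤ → ℤ × ℤ → Prop :=
  Relation.ReflTransGen fun a b => TriAdj a b ∧ b ∈ S

/-- `S` contains a left-right crossing of `[0, n]²` along the triangular lattice. -/
def TriCross (n : ℤ) (S : Set (ℤ × ℤ)) : Prop :=
  ∃ u ∈ S, ∃ v, u.1 = 0 ∧ v.1 = n ∧ TriReach S u v

lemma TriCross.mono {n : ℤ} {S T : Set (ℤ × ℤ)} (h : TriCross n S) (hST : S ⊆ T) :
    TriCross n T := by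
  obtain ⟨u, hu, v, h0, hn, hr⟩ := h
  exact ⟨u, hST hu, v, h0, hn, Relation.ReflTransGen.mono
    (fun a b hab => ⟨hab.1, hST hab.2⟩) u v hr⟩

lemma triAdj_swap {u v : ℤ × ℤ} (h : TriAdj u v) : TriAdj u.swap v.swap := by
  simp only [TriAdj, Prod.fst_swap, Prod.snd_swap] at h ⊢
  omega

lemma TriReach.swap {S : Set (ℤ × ℤ)} {u v : ℤ × ℤ} (h : TriReach S u v) :
    TriReach (Prod.swap ⁻¹' S) u.swap v.swap :=
  Relation.ReflTransGen.lift Prod.swap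
    (fun a b hab => ⟨triAdj_swap hab.1, by simpa using hab.2⟩) u v h

open Classical in
/-- The Hex theorem: if two sets cover the square `[0, n]²`, then the first one contains a
left-right crossing or the second one contains a bottom-top crossing. -/
theorem triCross_or_triCross_swap (n : ℕ) (S T : Set (ℤ × ℤ))
    (hS : ∀ v ∈ S, 0 ≤ v.1 ∧ v.1 ≤ n ∧ 0 ≤ v.2 ∧ v.2 ≤ n)
    (hT : ∀ v ∈ T, 0 ≤ v.1 ∧ v.1 ≤ n ∧ 0 ≤ v.2 ∧ v.2 ≤ n)
    (hST : ∀ v : ℤ × ℤ, 0 ≤ v.1 → v.1 ≤ n → 0 ≤ v.2 → v.2 ≤ n → v ∈ S ∨ v ∈ T) :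
    TriCross n S ∨ TriCross n (Prod.swap ⁻¹' T) := by
  by_contra hcon
  obtain ⟨hA, hB⟩ := not_or.1 hcon
  set RA : ℤ × ℤ → Prop := fun v => v ∈ S ∧ ∃ u ∈ S, u.1 = 0 ∧ TriReach S u v with hRA
  set RB : ℤ × ℤ → Prop := fun v => v ∈ T ∧ ∃ u ∈ T, u.2 = 0 ∧ TriReach T u v with hRB
  have hRA1 : ∀ v, RA v → v.1 ≠ n := fun v ⟨_, u, hu, h0, hr⟩ hn => hA ⟨u, hu, v, h0, hn, hr⟩
  have hRB1 : ∀ v, RB v → v.2 ≠ n := fun v ⟨_, u, hu, h0, hr⟩ hn =>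
    hB ⟨u.swap, by simpa using hu, v.swap, by simpa using h0, by simpa using hn, hr.swap⟩
  have hRA2 : ∀ v w, RA v → TriAdj v w → w ∈ S → RA w := fun v w ⟨_, u, hu, h0, hr⟩ hvw hw =>
    ⟨hw, u, hu, h0, hr.tail ⟨hvw, hw⟩⟩
  have hRB2 : ∀ v w, RB v → TriAdj v w → w ∈ T → RB w := fun v w ⟨_, u, hu, h0, hr⟩ hvw hw =>
    ⟨hw, u, hu, h0, hr.tail ⟨hvw, hw⟩⟩
  have hRA0 : ∀ v ∈ S, v.1 = 0 → RA v := fun v hv h0 => ⟨hv, v, hv, h0, .refl⟩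
  have hRB0 : ∀ v ∈ T, v.2 = 0 → RB v := fun v hv h0 => ⟨hv, v, hv, h0, .refl⟩
  -- The square is framed by one extra layer on every side. The left column counts as joined to the
  -- left side and gets label `0`; the rest of the bottom row gets label `1`. The layers at `n + 1`
  -- get label `2`, apart from their ends on those two sides.
  set LA : ℤ × ℤ → Prop := fun v => v.1 = -1 ∨ RA v with hLA
  set LB : ℤ × ℤ → Prop := fun v => 0 ≤ v.1 ∧ (v.2 = -1 ∨ RB v) with hLB
  set lab : ℤ × ℤ → Fin 3 := fun v => if LA v then 0 else if LB v then 1 else 2 with hlab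
  have lab0 : ∀ v, lab v = 0 → LA v := by
    intro v hv; by_contra h; by_cases h' : LB v <;> simp [hlab, h, h'] at hv
  have lab1 : ∀ v, lab v = 1 → LB v := by
    intro v hv; by_contra h'; by_cases h : LA v <;> simp [hlab, h, h'] at hv
  have lab2 : ∀ v, lab v = 2 → ¬ LA v ∧ ¬ LB v := by
    intro v hv; by_cases h : LA v <;> by_cases h' : LB v <;> simp [hlab, h, h'] at hv ⊢
  -- No triangle has all three labels: its vertex `c` labelled `2` would lie in the square, hence in
  -- `S` or in `T`, and would inherit label `0` or `1` from its neighbour. That `c` is not in the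
  -- frame uses the absence of both crossings.
  have key : ∀ a b c : ℤ × ℤ, TriAdj a c → TriAdj b c →
      (-1 ≤ c.1 ∧ c.1 ≤ n + 1 ∧ -1 ≤ c.2 ∧ c.2 ≤ n + 1) →
      lab a = 0 → lab b = 1 → lab c = 2 → False := by
    intro a b c hac hbc hc ha hb hc2
    have ha := lab0 a ha
    have hb := lab1 b hb
    obtain ⟨hcA, hcB⟩ := lab2 c hc2
    simp only [hLA, not_or] at hcA
    simp only [hLB, not_and, not_or] at hcB
    have hc0 : 0 ≤ c.1 := by omega
    obtain ⟨hcB1, hcB2⟩ := hcB hc0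
    have haS : RA a → a.1 ≤ n ∧ 0 ≤ a.1 ∧ a.1 ≠ n :=
      fun h => ⟨(hS a h.1).2.1, (hS a h.1).1, hRA1 a h⟩
    have hbT : RB b → b.2 ≤ n ∧ 0 ≤ b.2 ∧ b.2 ≠ n :=
      fun h => ⟨(hT b h.1).2.2.2, (hT b h.1).2.2.1, hRB1 b h⟩
    have hac' := hac
    have hbc' := hbc
    simp only [TriAdj] at hac' hbc'
    have hc1n : c.1 ≤ n := by
      rcases ha with ha | ha
      · omega
      · have := haS ha; omega
    have hc2n : c.2 ≤ n := by
      rcases hb.2 with hb | hb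
      · omega
      · have := hbT hb; omega
    rcases hST c hc0 hc1n (by omega) hc2n with hcS | hcT
    · rcases ha with ha | ha
      · exact hcA.2 (hRA0 c hcS (by omega))
      · exact hcA.2 (hRA2 a c ha hac hcS)
    · rcases hb.2 with hb | hb
      · exact hcB2 (hRB0 c hcT (by omega))
      · exact hcB2 (hRB2 b c hb hbc hcT)
  have key' : ∀ a b c : ℤ × ℤ, TriAdj a b → TriAdj b c → TriAdj a c →
      TriAdj b a → TriAdj c b → TriAdj c a →
      (-1 ≤ a.1 ∧ a.1 ≤ n + 1 ∧ -1 ≤ a.2 ∧ a.2 ≤ n + 1) →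
      (-1 ≤ b.1 ∧ b.1 ≤ n + 1 ∧ -1 ≤ b.2 ∧ b.2 ≤ n + 1) →
      (-1 ≤ c.1 ∧ c.1 ≤ n + 1 ∧ -1 ≤ c.2 ∧ c.2 ≤ n + 1) →
      ¬ (lab a ≠ lab b ∧ lab b ≠ lab c ∧ lab a ≠ lab c) := by
    intro a b c h1 h2 h3 h4 h5 h6 ba bb bc ⟨n1, n2, n3⟩
    have cases3 : ∀ x y z : Fin 3, x ≠ y → y ≠ z → x ≠ z →
        (x = 0 ∧ y = 1 ∧ z = 2) ∨ (x = 0 ∧ z = 1 ∧ y = 2) ∨ (y = 0 ∧ x = 1 ∧ z = 2) ∨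
        (y = 0 ∧ z = 1 ∧ x = 2) ∨ (z = 0 ∧ x = 1 ∧ y = 2) ∨ (z = 0 ∧ y = 1 ∧ x = 2) := by decide
    rcases cases3 _ _ _ n1 n2 n3 with ⟨x, y, z⟩ | ⟨x, y, z⟩ | ⟨x, y, z⟩ | ⟨x, y, z⟩ | ⟨x, y, z⟩ |
      ⟨x, y, z⟩
    · exact key a b c h3 h2 bc x y z
    · exact key a c b h1 h5 bb x y z
    · exact key b a c h2 h3 bc x y z
    · exact key b c a h4 h6 ba x y z
    · exact key c a b h5 h1 bb x y z
    · exact key c b a h6 h4 ba x y z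
  set l : ℕ → ℕ → Fin 3 := fun i j => lab ((i : ℤ) - 1, (j : ℤ) - 1) with hl
  have hsum := sum_labelEdge_boundary l (n + 2) (n + 2)
    (by intro i hi j hj
        refine key' _ _ _ ?_ ?_ ?_ ?_ ?_ ?_ ?_ ?_ ?_ <;> simp only [TriAdj] <;> push_cast <;> omega)
    (by intro i hi j hj
        refine key' _ _ _ ?_ ?_ ?_ ?_ ?_ ?_ ?_ ?_ ?_ <;> simp only [TriAdj] <;> push_cast <;> omega)
  have hleft : ∀ j, l 0 j = 0 := by intro j; simp [hl, hlab, hLA]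
  have hbot : ∀ i, l (i + 1) 0 = 1 := by
    intro i
    have h1 : ¬ LA (((i + 1 : ℕ) : ℤ) - 1, ((0 : ℕ) : ℤ) - 1) := by
      rintro (h | h)
      · push_cast at h; omega
      · simpa using (hS _ h.1).2.2.1
    have h2 : LB (((i + 1 : ℕ) : ℤ) - 1, ((0 : ℕ) : ℤ) - 1) := by
      exact ⟨by push_cast; omega, Or.inl (by simp)⟩
    simp only [hl, hlab, if_neg h1, if_pos h2]
  have hright : ∀ j, l (n + 2) j ≠ 0 := by
    intro j h
    rcases lab0 _ h with h | h
    · push_cast at h; omega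
    · have := (hS _ h.1).2.1; push_cast at this; omega
  have htop : ∀ i, l i (n + 2) ≠ 1 := by
    intro i h
    rcases (lab1 _ h).2 with h | h
    · push_cast at h; omega
    · have := (hT _ h.1).2.2.2; push_cast at this; omega
  -- The top side has no label `1`, the right side no label `0`, and the left side only `0`. The
  -- single `{0, 1}` edge of the boundary is the first one of the bottom row, which contradicts
  -- evenness.
  have e0 : ∀ a b : Fin 3, a ≠ 0 → b ≠ 0 → labelEdge a b = 0 := by unfold labelEdge; decide
  have e1 : ∀ a b : Fin 3, a ≠ 1 → b ≠ 1 → labelEdge a b = 0 := by unfold labelEdge; decide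
  rw [Finset.sum_eq_zero (s := Finset.range (n + 2)) (fun i _ => e1 _ _ (htop i) (htop (i + 1))),
    Finset.sum_eq_zero (s := Finset.range (n + 2))
      (f := fun j => labelEdge (l (n + 2) j) (l (n + 2) (j + 1)))
      (fun i _ => e0 _ _ (hright i) (hright (i + 1))),
    Finset.sum_eq_zero (s := Finset.range (n + 2))
      (f := fun j => labelEdge (l 0 j) (l 0 (j + 1)))
      (fun j _ => e1 _ _ (by simp [hleft]) (by simp [hleft])),
    Finset.sum_range_succ', Finset.sum_eq_zero (s := Finset.range (n + 1))
      (fun i _ => e0 _ _ (by simp [hbot]) (by simp [hbot])), hleft, hbot] at hsum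
  simp [labelEdge] at hsum

/-! ### Concentration of minimax functionals of Gaussian vectors -/

/-- A functional on `ℝ^V` which picks a coordinate depending only on the order of the coordinates
and is monotone and equivariant under adding constants. -/
structure IsMinimax {V : Type*} (F : (V → ℝ) → ℝ) : Prop where
  le_add : ∀ (x y : V → ℝ) (t : ℝ), (∀ v, x v ≤ y v + t) → F x ≤ F y + t
  select : ∀ x : V → ℝ, ∃ v, ∀ y : V → ℝ, (∀ u w, x u ≤ x w → y u ≤ y w) → F y = y v

section

variable {V : Type*} [Fintype V] {F : (V → ℝ) → ℝ}

lemma IsMinimax.abs_sub_le (hF : IsMinimax F) (x y : V → ℝ) : |F x - F y| ≤ ‖x - y‖ := by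
  have h : ∀ a b : V → ℝ, F a ≤ F b + ‖a - b‖ := fun a b => hF.le_add a b _ fun v => by
    have := (le_abs_self _).trans (norm_le_pi_norm (a - b) v)
    simp only [Pi.sub_apply] at this
    linarith
  have h1 := h x y
  have h2 := h y x
  rw [norm_sub_rev] at h2
  exact abs_le.2 ⟨by linarith, by linarith⟩

lemma IsMinimax.continuous (hF : IsMinimax F) : Continuous F := by
  have : LipschitzWith 1 F := LipschitzWith.of_dist_le_mul fun x y => by
    simpa [Real.dist_eq, dist_eq_norm] using hF.abs_sub_le x y
  exact this.continuous

/-- At a point with distinct coordinates, a minimax functional is locally a coordinate. -/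
lemma IsMinimax.eventually_eq (hF : IsMinimax F) {x : V → ℝ} (hx : Function.Injective x) :
    ∃ v, ∀ᶠ y in 𝓝 x, F y = y v := by
  obtain ⟨v, hv⟩ := hF.select x
  refine ⟨v, ?_⟩
  have : ∀ᶠ y in 𝓝 x, ∀ u w, x u ≤ x w → y u ≤ y w := by
    refine eventually_all.2 fun u => eventually_all.2 fun w => ?_
    rcases lt_trichotomy (x u) (x w) with h | h | h
    · have := (((continuous_apply u).tendsto x).eventually_lt
        ((continuous_apply w).tendsto x) h)
      filter_upwards [this] with y hy _ using hy.le
    · rw [hx h]; exact Eventually.of_forall fun y _ => le_rfl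
    · exact Eventually.of_forall fun y h' => absurd h' (not_le.2 h)
  filter_upwards [this] with y hy using hv y hy

lemma abs_one_sub_cos_le (θ : ℝ) : |1 - cos θ| ≤ |θ| := by
  have h := Real.one_sub_sq_div_two_le_cos (x := θ)
  have h1 := Real.cos_le_one θ
  have h2 := Real.neg_one_le_cos θ
  rw [abs_of_nonneg (by linarith)]
  rcases le_or_gt |θ| 2 with h3 | h3
  · have : θ ^ 2 = |θ| * |θ| := by rw [← sq, sq_abs]
    nlinarith [abs_nonneg θ]
  · linarith

/-- The difference quotients of a minimax functional along a rotation. -/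
lemma IsMinimax.tendsto_rotation (hF : IsMinimax F) (c x : V → ℝ)
    (hx : Function.Injective (x + c)) (φ : ℝ) :
    ∃ v, ∀ y : V → ℝ, Tendsto (fun k : ℕ => (k : ℝ) *
      (F (cos (φ / k) • x + sin (φ / k) • y + c) - F (x + c))) atTop (𝓝 (φ * y v)) := by
  obtain ⟨v, hv⟩ := hF.eventually_eq hx
  refine ⟨v, fun y => ?_⟩
  have hlim : Tendsto (fun k : ℕ => φ / k) atTop (𝓝 0) :=
    tendsto_const_nhds.div_atTop tendsto_natCast_atTop_atTop
  have hcurve : Tendsto (fun k : ℕ => cos (φ / k) • x + sin (φ / k) • y + c) atTop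
      (𝓝 (x + c)) := by
    have h1 := (((Real.continuous_cos.tendsto 0).comp hlim).smul_const x).add
      (((Real.continuous_sin.tendsto 0).comp hlim).smul_const y)
    simpa using h1.add_const c
  have hd : HasDerivAt (fun t : ℝ => cos t * x v + sin t * y v) (y v) 0 := by
    have := ((Real.hasDerivAt_cos 0).mul_const (x v)).add
      ((Real.hasDerivAt_sin 0).mul_const (y v))
    convert! this using 1
    simp
  have h2 := hd.hasFDerivAt.lim φ (c := fun k : ℕ => (k : ℝ)) (l := atTop)
    (by simpa using tendsto_natCast_atTop_atTop (R := ℝ))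
  simp only [zero_add, smul_eq_mul, cos_zero, sin_zero, one_mul, zero_mul, add_zero] at h2
  have h3 : Tendsto (fun k : ℕ => (k : ℝ) * (cos (φ / k) * x v + sin (φ / k) * y v - x v)) atTop
      (𝓝 (φ * y v)) := by
    convert! h2 using 1
    ext k; rw [div_eq_inv_mul]
  refine h3.congr' ?_
  filter_upwards [hcurve.eventually hv] with k hk
  rw [hk, hv.self_of_nhds]
  simp only [Pi.add_apply, Pi.smul_apply, smul_eq_mul]
  ring

/-- A difference of two coordinates is a centered Gaussian, possibly degenerate. It avoids the
nonzero value `c w - c u` almost surely in either case, so the shift `c` makes a nondegeneracy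
assumption unnecessary. -/
lemma ae_injective_add {μ : Measure (V → ℝ)} [IsGaussian μ] (hμ : μ[id] = 0) {c : V → ℝ}
    (hc : Function.Injective c) : ∀ᵐ x ∂μ, Function.Injective (x + c) := by
  have h : ∀ u w : V, u ≠ w → ∀ᵐ x ∂μ, x u + c u ≠ x w + c w := by
    intro u w huw
    set L : StrongDual ℝ (V → ℝ) :=
      ContinuousLinearMap.proj (R := ℝ) (φ := fun _ : V => ℝ) u -
        ContinuousLinearMap.proj (R := ℝ) (φ := fun _ : V => ℝ) w with hL
    have hm : μ[L] = 0 := by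
      have := L.integral_comp_id_comm' (μ := μ) IsGaussian.integrable_id
      rw [hμ, map_zero] at this
      simpa using this
    have hlaw := IsGaussian.map_eq_gaussianReal (μ := μ) L
    rw [hm] at hlaw
    have hne : c w - c u ≠ 0 := fun h0 => huw (hc (by linarith))
    have h0 : (μ.map L) {c w - c u} = 0 := by
      rw [hlaw]
      by_cases hv : Var[L; μ].toNNReal = 0
      · rw [hv, gaussianReal_zero_var]
        simp [hne.symm]
      · have := nullSingletonClass_gaussianReal (μ := 0) hv
        exact measure_singleton _
    rw [Measure.map_apply (by fun_prop) (measurableSet_singleton _)] at h0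
    refine measure_mono_null (fun x hx => ?_) h0
    simp only [ne_eq, Set.mem_compl_iff, Set.mem_ofPred_eq, not_not] at hx
    simp only [Set.mem_preimage, Set.mem_singleton_iff, hL, FunLike.coe_sub,
      Pi.sub_apply, ContinuousLinearMap.proj_apply]
    linarith
  have h2 : ∀ᵐ x ∂μ, ∀ u w : V, u ≠ w → x u + c u ≠ x w + c w := by
    refine eventually_all.2 fun u => eventually_all.2 fun w => ?_
    by_cases huw : u = w
    · simp [huw]
    · filter_upwards [h u w huw] with x hx _ using hx
  filter_upwards [h2] with x hx u w huw
  by_contra hne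
  exact hx u w hne huw

/-- Poincaré inequality for a minimax functional of a centered Gaussian vector. -/
theorem IsMinimax.integral_sq_sub_le (hF : IsMinimax F) {μ : Measure (V → ℝ)} [IsGaussian μ]
    (hμ : μ[id] = 0) {c : V → ℝ} (hc : Function.Injective c) {s : ℝ}
    (hs : ∀ v, ∫ x, (x v) ^ 2 ∂μ ≤ s) :
    ∫ z : (V → ℝ) × (V → ℝ), (F (z.1 + c) - F (z.2 + c)) ^ 2 ∂(μ.prod μ) ≤ (π / 2) ^ 2 * s := by
  set G : (V → ℝ) → ℝ := fun x => F (x + c) with hG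
  have hGc : Continuous G := hF.continuous.comp (by fun_prop)
  have hGl : ∀ x y, |G x - G y| ≤ ‖x - y‖ := fun x y => by
    simpa using hF.abs_sub_le (x + c) (y + c)
  set ν := μ.prod μ with hν
  set R : ℝ → (V → ℝ) × (V → ℝ) → (V → ℝ) × (V → ℝ) :=
    fun θ => ContinuousLinearMap.rotation θ with hR
  have hRc : ∀ θ, Continuous (R θ) := fun θ => by simp only [hR]; fun_prop
  have hRmp : ∀ θ, MeasurePreserving (R θ) ν ν := fun θ =>
    ⟨(hRc θ).measurable, IsGaussian.map_rotation_eq_self hμ θ⟩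
  have hRadd : ∀ a b z, R a (R b z) = R (a + b) z := by
    intro a b z
    simp only [hR, ContinuousLinearMap.rotation_apply, cos_add, sin_add]
    ext v <;> simp <;> ring
  have hmem : MemLp (fun x : V → ℝ => x) 2 μ := IsGaussian.memLp_id μ 2 (by simp)
  have hm1 : MemLp (fun z : (V → ℝ) × (V → ℝ) => ‖z.1‖) 2 ν :=
    hmem.norm.comp_measurePreserving measurePreserving_fst
  have hm2 : MemLp (fun z : (V → ℝ) × (V → ℝ) => ‖z.2‖) 2 ν :=
    hmem.norm.comp_measurePreserving measurePreserving_snd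
  have hbd : Integrable (fun z : (V → ℝ) × (V → ℝ) => (π / 2 * (‖z.1‖ + ‖z.2‖)) ^ 2) ν :=
    ((hm1.add hm2).const_mul (π / 2)).integrable_sq
  -- Rotating an independent pair by `π / 2` turns the first copy into the second, and every
  -- rotation preserves the product law. The path between them is split into `k` steps of angle `φ /
  -- k`.
  set φ : ℝ := π / 2 with hφ
  have hφ0 : 0 < φ := by positivity
  set U : ℕ → (V → ℝ) × (V → ℝ) → ℝ :=
    fun k z => ((k : ℝ) * (G ((R (φ / k) z).1) - G z.1)) ^ 2 with hU
  have hUb : ∀ (k : ℕ) z, |(k : ℝ) * (G ((R (φ / k) z).1) - G z.1)| ≤ φ * (‖z.1‖ + ‖z.2‖) := by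
    intro k z
    rcases Nat.eq_zero_or_pos k with rfl | hk
    · simp only [Nat.cast_zero, zero_mul, abs_zero]; positivity
    have hk' : (0 : ℝ) < k := by exact_mod_cast hk
    have h1 : ‖(R (φ / k) z).1 - z.1‖ ≤ φ / k * (‖z.1‖ + ‖z.2‖) := by
      have e : (R (φ / k) z).1 - z.1 = (cos (φ / k) - 1) • z.1 + sin (φ / k) • z.2 := by
        simp only [hR, ContinuousLinearMap.rotation_apply]
        module
      rw [e]
      refine (norm_add_le _ _).trans ?_
      rw [norm_smul, norm_smul, mul_add]
      have h0 : 0 ≤ φ / k := by positivity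
      have h2 := abs_one_sub_cos_le (φ / k)
      have h3 := Real.abs_sin_le_abs (x := φ / k)
      rw [abs_of_nonneg h0] at h2 h3
      rw [Real.norm_eq_abs, Real.norm_eq_abs, abs_sub_comm]
      gcongr
    rw [abs_mul, abs_of_pos hk']
    calc (k : ℝ) * |G ((R (φ / k) z).1) - G z.1| ≤ k * (φ / k * (‖z.1‖ + ‖z.2‖)) := by
          gcongr; exact (hGl _ _).trans h1
      _ = φ * (‖z.1‖ + ‖z.2‖) := by field_simp
  have hUm : ∀ k, AEStronglyMeasurable (U k) ν := fun k => by
    have h1 : Continuous (U k) := by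
      have := hRc (φ / k)
      simp only [hU]
      fun_prop
    exact h1.aestronglyMeasurable
  have hUb2 : ∀ (k : ℕ) z, ‖U k z‖ ≤ (φ * (‖z.1‖ + ‖z.2‖)) ^ 2 := fun k z => by
    rw [Real.norm_eq_abs, abs_of_nonneg (sq_nonneg _)]
    simp only [hU]
    rw [← sq_abs]
    exact pow_le_pow_left₀ (abs_nonneg _) (hUb k z) 2
  have hUi : ∀ k, Integrable (U k) ν := fun k =>
    hbd.mono' (hUm k) (Eventually.of_forall (hUb2 k))
  -- the discrete rotation path
  have hchain : ∀ k : ℕ, 0 < k →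
      ∫ z, (G z.1 - G z.2) ^ 2 ∂ν ≤ ∫ z, U k z ∂ν := by
    intro k hk
    have hk' : (0 : ℝ) < k := by exact_mod_cast hk
    have htel : ∀ z, G z.2 - G z.1 = ∑ j ∈ Finset.range k,
        (G ((R (φ / k) (R (j * (φ / k)) z)).1) - G ((R (j * (φ / k)) z).1)) := by
      intro z
      have e := Finset.sum_range_sub (fun j : ℕ => G ((R (j * (φ / k)) z).1)) k
      have e1 : (k : ℝ) * (φ / k) = π / 2 := by rw [hφ]; field_simp
      simp only [e1] at e
      have e2 : (R (π / 2) z).1 = z.2 := by simp [hR, ContinuousLinearMap.rotation_apply]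
      have e3 : (R ((0 : ℕ) * (φ / k)) z).1 = z.1 := by
        simp [hR, ContinuousLinearMap.rotation_apply]
      rw [e2, e3] at e
      rw [← e]
      refine Finset.sum_congr rfl fun j _ => ?_
      rw [hRadd]
      congr 4
      push_cast; ring
    -- Cauchy–Schwarz on the telescoping sum of `k` increments; the factor `k ^ 2` built into `U k`
    -- leaves an average of `k` terms that all have the same integral.
    have hpt : ∀ z, (G z.1 - G z.2) ^ 2 ≤
        (k : ℝ)⁻¹ * ∑ j ∈ Finset.range k, U k (R (j * (φ / k)) z) := by
      intro z
      have e := sq_sum_le_card_mul_sum_sq (s := Finset.range k) (f := fun j : ℕ =>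
        (G ((R (φ / k) (R (j * (φ / k)) z)).1) - G ((R (j * (φ / k)) z).1)))
      rw [← htel, Finset.card_range] at e
      have e2 : (G z.1 - G z.2) ^ 2 = (G z.2 - G z.1) ^ 2 := by ring
      rw [e2]
      refine e.trans (le_of_eq ?_)
      simp only [hU, mul_pow, ← Finset.mul_sum]
      field_simp
    have hint : ∀ j : ℕ, Integrable (fun z => U k (R (j * (φ / k)) z)) ν := fun j =>
      (hRmp _).integrable_comp_of_integrable (hUi k)
    have hval : ∀ j : ℕ, ∫ z, U k (R (j * (φ / k)) z) ∂ν = ∫ z, U k z ∂ν := fun j => by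
      have := integral_map (μ := ν) (hRc (j * (φ / k))).measurable.aemeasurable
        (f := U k) (by rw [(hRmp _).map_eq]; exact hUm k)
      rw [← this, (hRmp _).map_eq]
    calc ∫ z, (G z.1 - G z.2) ^ 2 ∂ν
        ≤ ∫ z, (k : ℝ)⁻¹ * ∑ j ∈ Finset.range k, U k (R (j * (φ / k)) z) ∂ν := by
          refine integral_mono_of_nonneg (Eventually.of_forall fun z => sq_nonneg _) ?_
            (Eventually.of_forall hpt)
          exact (integrable_finsetSum _ fun j _ => hint j).const_mul _
      _ = ∫ z, U k z ∂ν := by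
          rw [integral_const_mul, integral_finsetSum _ fun j _ => hint j]
          simp only [hval, Finset.sum_const, Finset.card_range, nsmul_eq_mul]
          field_simp
  -- the limit
  have hex : ∀ x : V → ℝ, ∃ v, Function.Injective (x + c) → ∀ y : V → ℝ,
      Tendsto (fun k => U k (x, y)) atTop (𝓝 ((φ * y v) ^ 2)) := by
    intro x
    by_cases hx : Function.Injective (x + c)
    · obtain ⟨v, hv⟩ := hF.tendsto_rotation c x hx φ
      exact ⟨v, fun _ y => by
        simpa [hU, hG, hR, ContinuousLinearMap.rotation_apply] using (hv y).pow 2⟩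
    · exact ⟨(hF.select x).choose, fun h => absurd h hx⟩
  choose w hw using hex
  set f : (V → ℝ) × (V → ℝ) → ℝ := fun z => (φ * z.2 (w z.1)) ^ 2 with hf
  have hae : ∀ᵐ z ∂ν, Tendsto (fun k => U k z) atTop (𝓝 (f z)) := by
    have := (Measure.quasiMeasurePreserving_fst (μ := μ) (ν := μ)).ae (ae_injective_add hμ hc)
    filter_upwards [this] with z hz using hw z.1 hz z.2
  have hfm : AEStronglyMeasurable f ν := aestronglyMeasurable_of_tendsto_ae atTop hUm hae
  have hfi : Integrable f ν := by
    refine hbd.mono' hfm (Eventually.of_forall fun z => ?_)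
    rw [Real.norm_eq_abs, abs_of_nonneg (sq_nonneg _)]
    simp only [hf]
    rw [← sq_abs, abs_mul, abs_of_pos hφ0]
    have h1 : |z.2 (w z.1)| ≤ ‖z.2‖ := norm_le_pi_norm z.2 _
    have h2 := norm_nonneg z.1
    gcongr
    linarith
  have hlim := tendsto_integral_of_dominated_convergence _ hUm hbd
    (fun k => Eventually.of_forall (hUb2 k)) hae
  have hle : ∫ z, (G z.1 - G z.2) ^ 2 ∂ν ≤ ∫ z, f z ∂ν :=
    ge_of_tendsto hlim ((eventually_gt_atTop 0).mono hchain)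
  refine hle.trans ?_
  rw [integral_prod f hfi]
  calc ∫ x, ∫ y, f (x, y) ∂μ ∂μ ≤ ∫ _, φ ^ 2 * s ∂μ := by
        refine integral_mono hfi.integral_prod_left (integrable_const _) fun x => ?_
        simp only [hf, mul_pow]
        rw [integral_const_mul]
        gcongr
        exact hs _
    _ = φ ^ 2 * s := by simp
end

/-! ### Minimax levels of monotone families of sets -/

/-- The least level `t` at which the sublevel set of `x` belongs to the family `C`. -/
def minimaxLevel {V : Type*} (C : Set (Set V)) (x : V → ℝ) : ℝ := sInf {t | {v | x v ≤ t} ∈ C}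

section

variable {V : Type*} [Fintype V] {C : Set (Set V)}

/-- The level is attained at a coordinate `v` of least value whose sublevel set is in `C`. For `y`
preserving the weak order of `x`, a lower admissible level would put the strict sublevel set of `x
v` in `C`. That set is nonempty because `∅ ∉ C`, and its largest coordinate contradicts the choice
of `v`. -/
lemma exists_isLeast_level (hmono : ∀ S T, S ⊆ T → S ∈ C → T ∈ C) (huniv : Set.univ ∈ C)
    (hempty : ∅ ∉ C) (x : V → ℝ) :
    ∃ v, ∀ y : V → ℝ, (∀ u w, x u ≤ x w → y u ≤ y w) → IsLeast {t | {u | y u ≤ t} ∈ C} (y v) := by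
  classical
  have hne : Nonempty V := by
    by_contra h
    rw [not_nonempty_iff] at h
    exact hempty (by rwa [← Set.univ_eq_empty_iff.2 h])
  obtain ⟨m, hm⟩ := Finite.exists_max x
  set T : Set V := {v | {u | x u ≤ x v} ∈ C} with hT
  have hmT : m ∈ T := by
    have : {u | x u ≤ x m} = Set.univ := Set.eq_univ_of_forall hm
    simpa [hT, this] using huniv
  obtain ⟨v, hvT, hv⟩ := T.toFinite.exists_minimalFor x T ⟨m, hmT⟩
  refine ⟨v, fun y hy => ⟨hmono _ _ (fun u hu => hy _ _ hu) hvT, fun t ht => ?_⟩⟩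
  by_contra hlt
  rw [not_le] at hlt
  have hsub : {u | y u ≤ t} ⊆ {u | x u < x v} := fun u hu => by
    by_contra h
    have h1 := hy _ _ (not_lt.1 h)
    have h2 : y u ≤ t := hu
    linarith
  have hC : {u | x u < x v} ∈ C := hmono _ _ hsub ht
  have hne' : {u | x u < x v}.Nonempty := by
    rw [Set.nonempty_iff_ne_empty]
    intro h; rw [h] at hC; exact hempty hC
  obtain ⟨w, hw, hwm⟩ := ({u | x u < x v}).toFinite.exists_maximalFor x _ hne'
  have hwT : w ∈ T := hmono _ _ (fun u hu => by
    rcases le_total (x u) (x w) with h | h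
    · exact h
    · exact hwm hu h) hC
  have := hv hwT (le_of_lt hw)
  exact absurd hw (not_lt.2 this)

lemma minimaxLevel_mem (hmono : ∀ S T, S ⊆ T → S ∈ C → T ∈ C) (huniv : Set.univ ∈ C)
    (hempty : ∅ ∉ C) (x : V → ℝ) : {v | x v ≤ minimaxLevel C x} ∈ C := by
  obtain ⟨v, hv⟩ := exists_isLeast_level hmono huniv hempty x
  have := hv x fun _ _ h => h
  rw [minimaxLevel, this.csInf_eq]
  exact this.1

lemma minimaxLevel_le (hmono : ∀ S T, S ⊆ T → S ∈ C → T ∈ C) (huniv : Set.univ ∈ C)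
    (hempty : ∅ ∉ C) {x : V → ℝ} {t : ℝ} (ht : {v | x v ≤ t} ∈ C) : minimaxLevel C x ≤ t := by
  obtain ⟨v, hv⟩ := exists_isLeast_level hmono huniv hempty x
  have := hv x fun _ _ h => h
  rw [minimaxLevel, this.csInf_eq]
  exact this.2 ht

lemma isMinimax_minimaxLevel (hmono : ∀ S T, S ⊆ T → S ∈ C → T ∈ C) (huniv : Set.univ ∈ C)
    (hempty : ∅ ∉ C) : IsMinimax (minimaxLevel C) where
  le_add x y t hxy := minimaxLevel_le hmono huniv hempty <|
    hmono _ _ (fun v hv => (hxy v).trans (by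
      have : y v ≤ minimaxLevel C y := hv
      show y v + t ≤ _
      linarith)) (minimaxLevel_mem hmono huniv hempty y)
  select x := by
    obtain ⟨v, hv⟩ := exists_isLeast_level hmono huniv hempty x
    exact ⟨v, fun y hy => (hv y hy).csInf_eq⟩

/-- Supplies the shift separating the coordinates; its values in `[0, 1]` cost only the `1` in `d -
1` below. -/
lemma exists_injective_unitInterval (V : Type*) [Finite V] :
    ∃ c : V → ℝ, Function.Injective c ∧ ∀ v, 0 ≤ c v ∧ c v ≤ 1 := by
  obtain ⟨f⟩ : Nonempty (V ↪ Set.Icc (0 : ℝ) 1) := by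
    have : Infinite (Set.Icc (0 : ℝ) 1) := Set.infinite_coe_iff.2 (Set.Icc_infinite one_pos)
    cases nonempty_fintype V
    exact ⟨(Function.Embedding.trans (Fintype.equivFin V).toEmbedding
      (⟨fun i : Fin _ => (i : ℕ), Fin.val_injective⟩ : _ ↪ ℕ)).trans
      (Infinite.natEmbedding _)⟩
  exact ⟨fun v => f v, Subtype.val_injective.comp f.injective, fun v => (f v).2⟩

/-- Upper tail of a minimax functional which is nonpositive with probability at least `1/2`. -/
lemma IsMinimax.measureReal_gt_le {F : (V → ℝ) → ℝ} (hF : IsMinimax F) {μ : Measure (V → ℝ)}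
    [IsGaussian μ] (hμ : μ[id] = 0) {s : ℝ} (hs : ∀ v, ∫ x, (x v) ^ 2 ∂μ ≤ s)
    (hhalf : 1 / 2 ≤ μ.real {x | F x ≤ 0}) {d : ℝ} (hd : 1 < d) :
    μ.real {x | d < F x} ≤ 2 * ((π / 2) ^ 2 * s) / (d - 1) ^ 2 := by
  obtain ⟨c, hc, hc01⟩ := exists_injective_unitInterval V
  have hFc := hF.continuous
  have hvar := hF.integral_sq_sub_le hμ hc hs
  have hmem : MemLp (fun x : V → ℝ => x) 2 μ := IsGaussian.memLp_id μ 2 (by simp)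
  have hint : Integrable (fun z : (V → ℝ) × (V → ℝ) => (F (z.1 + c) - F (z.2 + c)) ^ 2)
      (μ.prod μ) := by
    have h1 : MemLp (fun z : (V → ℝ) × (V → ℝ) => ‖z.1‖) 2 (μ.prod μ) :=
      hmem.norm.comp_measurePreserving measurePreserving_fst
    have h2 : MemLp (fun z : (V → ℝ) × (V → ℝ) => ‖z.2‖) 2 (μ.prod μ) :=
      hmem.norm.comp_measurePreserving measurePreserving_snd
    refine (h1.add h2).integrable_sq.mono' ?_ (Eventually.of_forall fun z => ?_)
    · exact Continuous.aestronglyMeasurable (by fun_prop)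
    · rw [Real.norm_eq_abs, abs_of_nonneg (sq_nonneg _), ← sq_abs]
      refine pow_le_pow_left₀ (abs_nonneg _) ((hF.abs_sub_le _ _).trans ?_) 2
      simpa using norm_sub_le z.1 z.2
  have hmk := mul_meas_ge_le_integral_of_nonneg
    (Eventually.of_forall fun z : (V → ℝ) × (V → ℝ) => sq_nonneg (F (z.1 + c) - F (z.2 + c)))
    hint ((d - 1) ^ 2)
  -- Two independent copies on opposite sides of the gap: after the shift their values still differ
  -- by at least `d - 1`. The first factor has probability at least `1/2`, hence the `2` in the
  -- bound.
  have hsub : {x | F x ≤ 0} ×ˢ {x | d < F x} ⊆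
      {z : (V → ℝ) × (V → ℝ) | (d - 1) ^ 2 ≤ (F (z.1 + c) - F (z.2 + c)) ^ 2} := by
    rintro ⟨x, y⟩ ⟨hx, hy⟩
    simp only [Set.mem_ofPred_eq] at hx hy ⊢
    have h1 := hF.le_add (x + c) x 1 fun v => by simpa using (hc01 v).2
    have h2 := hF.le_add y (y + c) 0 fun v => by simpa using (hc01 v).1
    nlinarith
  have hprod : (μ.prod μ).real ({x | F x ≤ 0} ×ˢ {x | d < F x}) =
      μ.real {x | F x ≤ 0} * μ.real {x | d < F x} := measureReal_prod_prod _ _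
  have hle := measureReal_mono (μ := μ.prod μ) hsub
  rw [hprod] at hle
  have hd2 : 0 < (d - 1) ^ 2 := by have : 0 < d - 1 := by linarith
                                   positivity
  rw [le_div_iff₀ hd2]
  have h0 : 0 ≤ μ.real {x | d < F x} := measureReal_nonneg
  have h3 : (1 / 2) * μ.real {x | d < F x} ≤ μ.real {x | F x ≤ 0} * μ.real {x | d < F x} := by
    gcongr
  have h4 := mul_le_mul_of_nonneg_left (h3.trans hle) hd2.le
  have h5 := h4.trans (hmk.trans hvar)
  linarith

end

/-- A centered Gaussian vector is determined in law by its covariances. -/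
lemma map_eq_map_of_cov_eq {V Ω : Type*} [Fintype V] [MeasurableSpace Ω] {P : Measure Ω}
    {X Y : Ω → V → ℝ} (hX : HasGaussianLaw X P) (hY : HasGaussianLaw Y P)
    (hX0 : ∀ v, ∫ ω, X ω v ∂P = 0) (hY0 : ∀ v, ∫ ω, Y ω v ∂P = 0)
    (hcov : ∀ u v, cov[fun ω => X ω u, fun ω => X ω v; P] =
      cov[fun ω => Y ω u, fun ω => Y ω v; P]) :
    P.map X = P.map Y := by
  classical
  have := hX.isProbabilityMeasure
  have := hX.isGaussian_map
  have := hY.isGaussian_map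
  have hdual : ∀ L : StrongDual ℝ (V → ℝ), ∃ a : V → ℝ, ∀ x, L x = ∑ v, a v * x v := by
    refine fun L => ⟨fun v => L (Pi.single v 1), fun x => ?_⟩
    have hx : x = ∑ v, x v • Pi.single v (1 : ℝ) := by
      ext w
      simp [Finset.sum_apply, Pi.single_apply]
    conv_lhs => rw [hx]
    rw [map_sum]
    exact Finset.sum_congr rfl fun v _ => by rw [map_smul, smul_eq_mul, mul_comm]
  have hm : ∀ (Z : Ω → V → ℝ), HasGaussianLaw Z P → ∀ v, MemLp (fun ω => Z ω v) 2 P :=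
    fun Z hZ v => (hZ.map_fun (ContinuousLinearMap.proj (R := ℝ) (φ := fun _ : V => ℝ) v)).memLp_two
  have hmean : ∀ (Z : Ω → V → ℝ), HasGaussianLaw Z P → (∀ v, ∫ ω, Z ω v ∂P = 0) →
      ∀ L : StrongDual ℝ (V → ℝ), ∫ ω, L (Z ω) ∂P = 0 := by
    intro Z hZ h0 L
    obtain ⟨a, ha⟩ := hdual L
    simp_rw [ha]
    rw [integral_finsetSum _ fun v _ => ((hm Z hZ v).integrable one_le_two).const_mul _]
    simp [integral_const_mul, h0]
  have hvar : ∀ L : StrongDual ℝ (V → ℝ),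
      Var[fun ω => L (X ω); P] = Var[fun ω => L (Y ω); P] := by
    intro L
    rw [← covariance_self (hX.map_fun L).aemeasurable,
      ← covariance_self (hY.map_fun L).aemeasurable]
    obtain ⟨a, ha⟩ := hdual L
    simp_rw [ha]
    rw [covariance_fun_sum_fun_sum (fun v => (hm X hX v).const_mul _)
      (fun v => (hm X hX v).const_mul _), covariance_fun_sum_fun_sum
      (fun v => (hm Y hY v).const_mul _) (fun v => (hm Y hY v).const_mul _)]
    simp_rw [covariance_const_mul_left, covariance_const_mul_right, hcov]
  refine Measure.ext_of_charFunDual ?_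
  ext L
  rw [hX.charFunDual_map_eq_fun, hY.charFunDual_map_eq_fun, hmean X hX hX0, hmean Y hY hY0, hvar]

/-! ### Covariances of the circle averages of the free field -/

lemma integrable_circleMeasure_of_continuous (z : ℂ) (r : ℝ) {f : ℂ → ℝ} (hf : Continuous f) :
    Integrable f (circleMeasure z r) :=
  integrable_circleMeasure z r hf.measurable hf.continuousOn.circleIntegrable'

lemma continuous_posLog_norm_sub (c : ℝ) (w : ℂ) : Continuous fun x : ℂ => log⁺ (c * ‖x - w‖) := by
  fun_prop

lemma continuous_posLog_norm : Continuous fun x : ℂ => log⁺ ‖x‖ := by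
  fun_prop

/-- Jensen's formula: for `r > 0` the value is `log (max r ‖x - w‖)`, written so that its dependence
on `x` is visibly continuous. -/
lemma integral_log_circleMeasure (x w : ℂ) {r : ℝ} (hr : r ≠ 0) :
    Integrable (fun y => Real.log ‖x - y‖) (circleMeasure w r) ∧
    ∫ y, Real.log ‖x - y‖ ∂(circleMeasure w r) = Real.log r + log⁺ (r⁻¹ * ‖x - w‖) := by
  have hm : Measurable fun y : ℂ => Real.log ‖y - x‖ :=
    Real.measurable_log.comp (measurable_id.sub_const x).norm
  constructor
  · simpa only [norm_sub_rev] using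
      integrable_circleMeasure w r hm (circleIntegrable_log_norm_sub_const r)
  · have e := integral_circleMeasure w r hm
    rw [circleAverage_log_norm_sub_const_eq_log_radius_add_posLog hr] at e
    simpa only [norm_sub_rev] using e

/-- The contribution of the positions to the covariances of circle averages. -/
def posLogAvg (z : ℂ) (r : ℝ) : ℝ := ∫ x, log⁺ ‖x‖ ∂(circleMeasure z r)

/-- The logarithmic interaction of two circles of radius `r`. -/
def interaction (z w : ℂ) (r : ℝ) : ℝ := ∫ x, log⁺ (r⁻¹ * ‖x - w‖) ∂(circleMeasure z r)

/-- Separates the covariance into position terms, bounded on the box, the divergent `-log r`, and an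
interaction that vanishes for `z = w` and is at most `1` for neighbours. -/
lemma integral_kernel_circleMeasure (z w : ℂ) {r : ℝ} (hr : r ≠ 0) :
    ∫ x, ∫ y, wholePlaneKernel x y ∂(circleMeasure w r) ∂(circleMeasure z r) =
      posLogAvg z r + posLogAvg w r - Real.log r - interaction z w r := by
  have h1 : ∀ x, ∫ y, wholePlaneKernel x y ∂(circleMeasure w r) =
      log⁺ ‖x‖ + (posLogAvg w r - Real.log r) - log⁺ (r⁻¹ * ‖x - w‖) := by
    intro x
    obtain ⟨hi, he⟩ := integral_log_circleMeasure x w hr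
    have hc := integrable_circleMeasure_of_continuous w r continuous_posLog_norm
    have hs : Integrable (fun y => log⁺ ‖x‖ + log⁺ ‖y‖) (circleMeasure w r) :=
      (integrable_const _).add hc
    simp only [wholePlaneKernel]
    rw [integral_sub hs hi, he, integral_add (integrable_const _) hc]
    simp [posLogAvg]
    ring
  simp_rw [h1]
  have hc := integrable_circleMeasure_of_continuous z r continuous_posLog_norm
  have hs : Integrable (fun x => log⁺ ‖x‖ + (posLogAvg w r - Real.log r)) (circleMeasure z r) :=
    hc.add (integrable_const _)
  rw [integral_sub hs
    (integrable_circleMeasure_of_continuous z r (continuous_posLog_norm_sub _ w)),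
    integral_add hc (integrable_const _)]
  simp [posLogAvg, interaction]
  ring

lemma posLogAvg_le {z : ℂ} {r : ℝ} (hr : 0 ≤ r) (h : ‖z‖ + r ≤ 3) : posLogAvg z r ≤ 2 := by
  have h3 : log⁺ (3 : ℝ) ≤ 2 := by
    rw [posLog_eq_log (by norm_num)]
    have := Real.log_le_sub_one_of_pos (show (0 : ℝ) < 3 by norm_num)
    linarith
  calc posLogAvg z r ≤ ∫ _, (2 : ℝ) ∂(circleMeasure z r) := by
        refine integral_mono_ae
          (integrable_circleMeasure_of_continuous z r continuous_posLog_norm)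
          (integrable_const _) ?_
        filter_upwards [ae_circleMeasure z r] with x hx
        refine (posLog_le_posLog (norm_nonneg _) ?_).trans h3
        rw [mem_sphere_iff_norm, abs_of_nonneg hr] at hx
        have := norm_add_le (x - z) z
        rw [sub_add_cancel] at this
        linarith
    _ = 2 := by simp

lemma interaction_self (z : ℂ) {r : ℝ} (hr : 0 < r) : interaction z z r = 0 := by
  refine integral_eq_zero_of_ae ?_
  filter_upwards [ae_circleMeasure z r] with x hx
  rw [mem_sphere_iff_norm, abs_of_pos hr] at hx
  simp [hx, hr.ne']

lemma interaction_le {z w : ℂ} {r : ℝ} (hr : 0 < r) (h : ‖z - w‖ ≤ r) :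
    interaction z w r ≤ 1 := by
  have h2 : log⁺ (2 : ℝ) ≤ 1 := by
    rw [posLog_eq_log (by norm_num)]
    have := Real.log_le_sub_one_of_pos (show (0 : ℝ) < 2 by norm_num)
    linarith
  calc interaction z w r ≤ ∫ _, (1 : ℝ) ∂(circleMeasure z r) := by
        refine integral_mono_ae
          (integrable_circleMeasure_of_continuous z r (continuous_posLog_norm_sub _ w))
          (integrable_const _) ?_
        filter_upwards [ae_circleMeasure z r] with x hx
        refine (posLog_le_posLog (by positivity) ?_).trans h2
        rw [mem_sphere_iff_norm, abs_of_pos hr] at hx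
        have := norm_add_le (x - z) (z - w)
        rw [sub_add_sub_cancel] at this
        rw [inv_mul_le_iff₀ hr]
        linarith
    _ = 1 := by simp

/-- The reflection exchanging the two coordinates of the plane. -/
def reflect (z : ℂ) : ℂ := ⟨z.im, z.re⟩

lemma norm_reflect (z : ℂ) : ‖reflect z‖ = ‖z‖ := by
  simp only [reflect, Complex.norm_def, Complex.normSq_apply, add_comm]

lemma reflect_sub (z w : ℂ) : reflect z - reflect w = reflect (z - w) := by
  apply Complex.ext <;> simp [reflect]

lemma circleMap_reflect (z : ℂ) (r θ : ℝ) :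
    circleMap (reflect z) r θ = reflect (circleMap z r (π / 2 - θ)) := by
  have h1 : ∀ t : ℝ, circleMap z r t = ⟨z.re + r * cos t, z.im + r * sin t⟩ := fun t => by
    apply Complex.ext <;> simp [circleMap, Complex.exp_ofReal_mul_I_re, Complex.exp_ofReal_mul_I_im]
  rw [h1, cos_pi_div_two_sub, sin_pi_div_two_sub]
  apply Complex.ext <;>
    simp [reflect, circleMap, Complex.exp_ofReal_mul_I_re, Complex.exp_ofReal_mul_I_im]

lemma circleAverage_reflect (f : ℂ → ℝ) (z : ℂ) (r : ℝ) :
    circleAverage f (reflect z) r = circleAverage (fun x => f (reflect x)) z r := by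
  rw [circleAverage_def, circleAverage_def]
  congr 1
  simp_rw [circleMap_reflect]
  rw [intervalIntegral.integral_comp_sub_left
    (fun θ => f (reflect (circleMap z r θ))) (π / 2)]
  -- Reversing the angle moves the interval of integration; periodicity moves it back.
  have hp : Function.Periodic (fun θ => f (reflect (circleMap z r θ))) (2 * π) := fun θ => by
    simp only [periodic_circleMap z r θ]
  have := hp.intervalIntegral_add_eq (π / 2 - 2 * π) 0
  simpa using this

lemma integral_reflect {f : ℂ → ℝ} (hf : Continuous f) (z : ℂ) (r : ℝ) :
    ∫ x, f x ∂(circleMeasure (reflect z) r) = ∫ x, f (reflect x) ∂(circleMeasure z r) := by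
  have hr : Measurable reflect := by
    have : Continuous reflect :=
      Complex.equivRealProdCLM.symm.continuous.comp
        (Complex.continuous_im.prodMk Complex.continuous_re)
    exact this.measurable
  have e := integral_circleMeasure z r (hf.measurable.comp hr)
  simp only [Function.comp_def] at e
  rw [integral_circleMeasure _ _ hf.measurable, e, circleAverage_reflect]

lemma posLogAvg_reflect (z : ℂ) (r : ℝ) : posLogAvg (reflect z) r = posLogAvg z r := by
  rw [posLogAvg, integral_reflect continuous_posLog_norm]
  simp [posLogAvg, norm_reflect]

lemma interaction_reflect (z w : ℂ) (r : ℝ) :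
    interaction (reflect z) (reflect w) r = interaction z w r := by
  rw [interaction, integral_reflect (continuous_posLog_norm_sub _ _)]
  simp [interaction, reflect_sub, norm_reflect]

/-! ### Gaussian laws and covariances of the circle averages -/

section Field

variable {Ω : Type*} [MeasurableSpace Ω] {P : Measure Ω} {h : Measure ℂ → Ω → ℝ}

lemma IsWholePlaneGFF.hasGaussianLaw_circleAvg (hh : IsWholePlaneGFF h P) {V : Type*} [Fintype V]
    (z : V → ℂ) {r : ℝ} (hr : 0 < r) :
    HasGaussianLaw (fun ω v => circleAvg h r (z v) ω) P := by
  have hp := hh.gaussian.comp_right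
    fun v : V => (⟨circleMeasure (z v) r, finiteLogEnergy_circleMeasure (z v) hr⟩ :
      {μ : Measure ℂ // FiniteLogEnergy μ})
  have h1 := hp.hasGaussianLaw Finset.univ
  let T : (((Finset.univ : Finset V) : Type _) → ℝ) →L[ℝ] (V → ℝ) :=
    ContinuousLinearMap.pi fun v =>
      ContinuousLinearMap.proj (R := ℝ) (φ := fun _ : ((Finset.univ : Finset V) : Type _) => ℝ)
        ⟨v, Finset.mem_univ v⟩
  exact h1.map_fun T

lemma IsWholePlaneGFF.cov_circleAvg (hh : IsWholePlaneGFF h P) (z w : ℂ) {r : ℝ} (hr : 0 < r) :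
    cov[circleAvg h r z, circleAvg h r w; P] =
      posLogAvg z r + posLogAvg w r - Real.log r - interaction z w r := by
  rw [← integral_kernel_circleMeasure z w hr.ne']
  exact hh.covariance _ _ (finiteLogEnergy_circleMeasure z hr) (finiteLogEnergy_circleMeasure w hr)

lemma IsWholePlaneGFF.integral_circleAvg (hh : IsWholePlaneGFF h P) (z : ℂ) {r : ℝ} (hr : 0 < r) :
    ∫ ω, circleAvg h r z ω ∂P = 0 :=
  hh.centered _ (finiteLogEnergy_circleMeasure z hr)

lemma IsWholePlaneGFF.law_circleAvg (hh : IsWholePlaneGFF h P) (z : ℂ) {r : ℝ} (hr : 0 < r) :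
    HasGaussianLaw (circleAvg h r z) P :=
  (hh.hasGaussianLaw_circleAvg (fun _ : Unit => z) hr).map_fun
    (ContinuousLinearMap.proj (R := ℝ) (φ := fun _ : Unit => ℝ) ())

lemma IsWholePlaneGFF.variance_circleAvg (hh : IsWholePlaneGFF h P) (z : ℂ) {r : ℝ} (hr : 0 < r) :
    Var[circleAvg h r z; P] = 2 * posLogAvg z r - Real.log r := by
  rw [← covariance_self (hh.law_circleAvg z hr).aemeasurable, hh.cov_circleAvg z z hr,
    interaction_self z hr]
  ring

/-- The position terms and `log r` cancel, so neighbour increments have variance bounded uniformly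
in the mesh. -/
lemma IsWholePlaneGFF.variance_sub_circleAvg (hh : IsWholePlaneGFF h P) (z w : ℂ) {r : ℝ}
    (hr : 0 < r) :
    Var[fun ω => circleAvg h r z ω - circleAvg h r w ω; P] = 2 * interaction z w r := by
  have := (hh.law_circleAvg z hr).isProbabilityMeasure
  have e := variance_sub (hh.law_circleAvg z hr).memLp_two (hh.law_circleAvg w hr).memLp_two
  rw [hh.variance_circleAvg z hr, hh.variance_circleAvg w hr, hh.cov_circleAvg z w hr] at e
  change Var[circleAvg h r z - circleAvg h r w; P] = _
  rw [e]
  ring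

lemma IsWholePlaneGFF.law_sub_circleAvg (hh : IsWholePlaneGFF h P) (z w : ℂ) {r : ℝ}
    (hr : 0 < r) : HasGaussianLaw (fun ω => circleAvg h r z ω - circleAvg h r w ω) P :=
  (hh.hasGaussianLaw_circleAvg (fun b : Bool => if b then z else w) hr).map_fun
    (ContinuousLinearMap.proj (R := ℝ) (φ := fun _ : Bool => ℝ) true -
      ContinuousLinearMap.proj (R := ℝ) (φ := fun _ : Bool => ℝ) false)

end Field

/-- Upper tail of a centered Gaussian variable. -/
lemma measure_ge_le_of_hasGaussianLaw {Ω : Type*} [MeasurableSpace Ω] {P : Measure Ω}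
    {X : Ω → ℝ} (hX : HasGaussianLaw X P) (h0 : ∫ ω, X ω ∂P = 0) {s : ℝ}
    (hs : Var[X; P] ≤ s) (hs0 : 0 < s) {t : ℝ} (ht : 0 ≤ t) :
    P {ω | t ≤ X ω} ≤ ENNReal.ofReal (exp (-t ^ 2 / (2 * s))) := by
  have := hX.isProbabilityMeasure
  have hlaw := hX.map_eq_gaussianReal
  rw [h0] at hlaw
  have hmgf := mgf_gaussianReal hlaw (t / s)
  have hint : Integrable (fun ω => exp (t / s * X ω)) P := by
    -- A non-integrable exponential would make the moment generating function the default `0`, but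
    -- it equals an exponential.
    by_contra hcon
    have h1 := mgf_undef hcon
    rw [hmgf] at h1
    exact (exp_pos _).ne' h1
  have hle := measure_ge_le_exp_mul_mgf (X := X) t (div_nonneg ht hs0.le) hint
  rw [hmgf, ← Real.exp_add] at hle
  rw [← ofReal_measureReal]
  refine ENNReal.ofReal_le_ofReal (hle.trans (Real.exp_le_exp.2 ?_))
  have hv : ((Var[X; P].toNNReal : NNReal) : ℝ) ≤ s := by
    rw [Real.coe_toNNReal _ (variance_nonneg _ _)]; exact hs
  have h2 : ((Var[X; P].toNNReal : NNReal) : ℝ) * (t / s) ^ 2 / 2 ≤ s * (t / s) ^ 2 / 2 := by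
    gcongr
  have h3 : -(t / s) * t + s * (t / s) ^ 2 / 2 = -t ^ 2 / (2 * s) := by field_simp; ring
  linarith

/-! ### Lattice paths in the box -/

/-- The side length of the box in lattice steps. -/
def boxSide (ε : ℝ) : ℕ := ⌊1 / ε⌋₊

lemma mem_Box_iff {ε : ℝ} (hε : 0 < ε) (v : ℤ × ℤ) :
    v ∈ Box ε ↔ 0 ≤ v.1 ∧ v.1 ≤ boxSide ε ∧ 0 ≤ v.2 ∧ v.2 ≤ boxSide ε := by
  have h1 : ∀ k : ℤ, ε * k ∈ Set.Icc (0 : ℝ) 1 ↔ 0 ≤ k ∧ k ≤ boxSide ε := by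
    intro k
    have e : (boxSide ε : ℤ) = ⌊1 / ε⌋ := Int.natCast_floor_eq_floor (by positivity)
    rw [Set.mem_Icc, e, Int.le_floor, le_div_iff₀' hε, mul_nonneg_iff_of_pos_left hε]
    norm_cast
  simp only [Box, Set.mem_ofPred_eq, h1]
  tauto

lemma Box_subset {ε : ℝ} (hε : 0 < ε) :
    Box ε ⊆ ((Finset.Icc (0 : ℤ) (boxSide ε)) ×ˢ (Finset.Icc (0 : ℤ) (boxSide ε)) :
      Finset (ℤ × ℤ)) := fun v hv => by
  rw [mem_Box_iff hε] at hv
  simp only [Finset.coe_product, Finset.coe_Icc, Set.mem_prod, Set.mem_Icc]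
  tauto

lemma finite_Box {ε : ℝ} (hε : 0 < ε) : Finite (Box ε) :=
  ((Finset.finite_toSet _).subset (Box_subset hε)).to_subtype

lemma card_Box_le {ε : ℝ} (hε : 0 < ε) (hε1 : ε ≤ 1) : (Nat.card (Box ε) : ℝ) ≤ 4 / ε ^ 2 := by
  have h1 : Nat.card (Box ε) ≤ (boxSide ε + 1) * (boxSide ε + 1) := by
    have := Set.ncard_le_ncard (Box_subset hε) (Finset.finite_toSet _)
    rw [Set.ncard_coe_finset, Finset.card_product, Int.card_Icc] at this
    simpa [Nat.card_coe_set_eq] using this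
  have h2 : (boxSide ε : ℝ) ≤ 1 / ε := Nat.floor_le (by positivity)
  have h3 : 1 ≤ 1 / ε := by rw [le_div_iff₀ hε]; linarith
  calc (Nat.card (Box ε) : ℝ) ≤ (boxSide ε + 1) * (boxSide ε + 1) := by exact_mod_cast h1
    _ ≤ (2 / ε) * (2 / ε) := by
        have : (boxSide ε : ℝ) + 1 ≤ 2 / ε := by
          have : 2 / ε = 1 / ε + 1 / ε := by ring
          linarith
        gcongr
    _ = 4 / ε ^ 2 := by ring

lemma norm_toPlane_le {ε : ℝ} (v : Box ε) : ‖toPlane ε v‖ ≤ 2 := by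
  obtain ⟨⟨h1, h2⟩, h3, h4⟩ := v.2
  refine (Complex.norm_le_abs_re_add_abs_im _).trans ?_
  simp only [toPlane]
  rw [abs_of_nonneg h1, abs_of_nonneg h3]
  linarith

lemma mem_leftBoundary {ε : ℝ} (hε : 0 < ε) {v : Box ε} (hv : v.1.1 = 0) :
    v ∈ leftBoundary ε := fun h => by
  rw [mem_Box_iff hε] at h
  simp only at h
  omega

lemma mem_rightBoundary {ε : ℝ} (hε : 0 < ε) {v : Box ε} (hv : v.1.1 = boxSide ε) :
    v ∈ rightBoundary ε := fun h => by
  rw [mem_Box_iff hε] at h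
  simp only at h
  omega

lemma zero_mem_Box {ε : ℝ} (hε : 0 < ε) : ((0, 0) : ℤ × ℤ) ∈ Box ε := by
  rw [mem_Box_iff hε]; simp

lemma nonempty_leftBoundary {ε : ℝ} (hε : 0 < ε) : Nonempty (leftBoundary ε) :=
  ⟨⟨⟨(0, 0), zero_mem_Box hε⟩, mem_leftBoundary hε rfl⟩⟩

lemma nonempty_rightBoundary {ε : ℝ} (hε : 0 < ε) : Nonempty (rightBoundary ε) :=
  ⟨⟨⟨(boxSide ε, 0), by rw [mem_Box_iff hε]; simp⟩, mem_rightBoundary hε rfl⟩⟩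

lemma boxGraph_reachable_zero {ε : ℝ} (hε : 0 < ε) (k : ℕ) : ∀ v : Box ε,
    v.1.1 + v.1.2 = k → (boxGraph ε).Reachable v ⟨(0, 0), zero_mem_Box hε⟩ := by
  induction k with
  | zero =>
    intro v hv
    have hb := (mem_Box_iff hε _).1 v.2
    have : v = ⟨(0, 0), zero_mem_Box hε⟩ := Subtype.ext (Prod.ext (by push_cast at hv; simp; omega)
      (by push_cast at hv; simp; omega))
    rw [this]
  | succ k ih =>
    intro v hv
    have hb := (mem_Box_iff hε _).1 v.2
    push_cast at hv
    by_cases h0 : v.1.1 = 0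
    · let w : Box ε := ⟨(v.1.1, v.1.2 - 1), by rw [mem_Box_iff hε]; simp only; omega⟩
      have hadj : (boxGraph ε).Adj v w := by simp [boxGraph, w]
      exact hadj.reachable.trans (ih w (by simp only [w]; omega))
    · let w : Box ε := ⟨(v.1.1 - 1, v.1.2), by rw [mem_Box_iff hε]; simp only; omega⟩
      have hadj : (boxGraph ε).Adj v w := by simp [boxGraph, w]
      exact hadj.reachable.trans (ih w (by simp only [w]; omega))

/-- Ensures that the infima over walks range over nonempty families, so the default value `0` of an
empty real infimum does not intervene. -/
lemma boxGraph_preconnected {ε : ℝ} (hε : 0 < ε) : (boxGraph ε).Preconnected := by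
  have h : ∀ v : Box ε, (boxGraph ε).Reachable v ⟨(0, 0), zero_mem_Box hε⟩ := fun v => by
    have hb := (mem_Box_iff hε _).1 v.2
    exact boxGraph_reachable_zero hε (v.1.1 + v.1.2).toNat v (by omega)
  exact fun v w => (h v).trans (h w).symm

/-- A path of the triangular lattice inside a sublevel set can be followed by a lattice path
along which the field is not much larger, if the horizontal increments of the field are small. -/
lemma exists_walk_of_triReach {ε : ℝ} (hε : 0 < ε) {x : Box ε → ℝ} {t d : ℝ} (hd : 0 ≤ d)
    (hinc : ∀ v w : Box ε, w.1 = (v.1.1 + 1, v.1.2) → x w - x v ≤ d) (u : Box ε) (hu : x u ≤ t)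
    {v : ℤ × ℤ} (h : TriReach (Subtype.val '' {v : Box ε | x v ≤ t}) u v) :
    ∃ w : Box ε, w.1 = v ∧ x w ≤ t ∧
      ∃ p : (boxGraph ε).Walk u w, ∀ y ∈ p.support, x y ≤ t + d := by
  induction h with
  | refl => exact ⟨u, rfl, hu, .nil, by simp; linarith⟩
  | @tail b c _ hbc ih =>
    obtain ⟨w, hwb, hwt, p, hp⟩ := ih
    obtain ⟨hadj, y, hy, hyc⟩ := hbc
    refine ⟨y, hyc, hy, ?_⟩
    have hy' : x y ≤ t := hy
    suffices hq : ∃ q : (boxGraph ε).Walk w y, ∀ z ∈ q.support, x z ≤ t + d by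
      obtain ⟨q, hq⟩ := hq
      refine ⟨p.append q, fun z hz => ?_⟩
      rcases (SimpleGraph.Walk.mem_support_append_iff _ _).1 hz with h | h
      · exact hp z h
      · exact hq z h
    subst hwb
    subst hyc
    have hbw := (mem_Box_iff hε _).1 w.2
    have hby := (mem_Box_iff hε _).1 y.2
    simp only [TriAdj] at hadj
    have step : ∀ a b : Box ε, (b.1.1 - a.1.1 = 0 ∧ (b.1.2 - a.1.2 = 1 ∨ b.1.2 - a.1.2 = -1)) ∨
        (b.1.2 - a.1.2 = 0 ∧ (b.1.1 - a.1.1 = 1 ∨ b.1.1 - a.1.1 = -1)) →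
        (boxGraph ε).Adj a b := by
      intro a b hab
      simp only [boxGraph]
      rw [abs_sub_comm, abs_sub_comm a.1.2]
      rcases hab with ⟨h1, h2 | h2⟩ | ⟨h1, h2 | h2⟩ <;> simp [h1, h2]
    -- A diagonal step is routed through the right neighbour `m` of its lower end, where the field
    -- exceeds that of `a` by at most `d`. Hence only horizontal increments have to be controlled.
    have diag : ∀ a b : Box ε, b.1.1 - a.1.1 = 1 → b.1.2 - a.1.2 = 1 → x a ≤ t → x b ≤ t →
        ∃ q : (boxGraph ε).Walk a b, ∀ z ∈ q.support, x z ≤ t + d := by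
      intro a b h1 h2 ha hb
      have hba := (mem_Box_iff hε _).1 a.2
      have hbb := (mem_Box_iff hε _).1 b.2
      let m : Box ε := ⟨(a.1.1 + 1, a.1.2), by rw [mem_Box_iff hε]; simp only; omega⟩
      have hm := hinc a m rfl
      have e1 : (boxGraph ε).Adj a m := step a m (by simp [m])
      have e2 : (boxGraph ε).Adj m b := step m b (by simp only [m]; omega)
      refine ⟨.cons e1 (.cons e2 .nil), fun z hz => ?_⟩
      simp only [SimpleGraph.Walk.support_cons, SimpleGraph.Walk.support_nil, List.mem_cons,
        List.not_mem_nil, or_false] at hz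
      rcases hz with rfl | rfl | rfl <;> linarith
    by_cases h1 : y.1.1 - w.1.1 = 1 ∧ y.1.2 - w.1.2 = 1
    · exact diag w y h1.1 h1.2 hwt hy'
    by_cases h2 : y.1.1 - w.1.1 = -1 ∧ y.1.2 - w.1.2 = -1
    · obtain ⟨q, hq⟩ := diag y w (by omega) (by omega) hy' hwt
      exact ⟨q.reverse, fun z hz => hq z (by simpa using hz)⟩
    by_cases h3 : y.1.1 - w.1.1 = 0 ∧ y.1.2 - w.1.2 = 0
    · have : y = w := Subtype.ext (Prod.ext (by omega) (by omega))
      subst this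
      exact ⟨.nil, by simp; linarith⟩
    · refine ⟨.cons (step w y (by omega)) .nil, fun z hz => ?_⟩
      simp only [SimpleGraph.Walk.support_cons, SimpleGraph.Walk.support_nil, List.mem_cons,
        List.not_mem_nil, or_false] at hz
      rcases hz with rfl | rfl <;> linarith

/-- The sets of vertices containing a left-right crossing along the triangular lattice. -/
def crossingSets (ε : ℝ) : Set (Set (Box ε)) := {S | TriCross (boxSide ε) (Subtype.val '' S)}

lemma crossingSets_mono (ε : ℝ) (S T : Set (Box ε)) (hST : S ⊆ T) (hS : S ∈ crossingSets ε) :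
    T ∈ crossingSets ε :=
  TriCross.mono hS (Set.image_mono hST)

lemma empty_notMem_crossingSets (ε : ℝ) : ∅ ∉ crossingSets ε := by
  rintro ⟨u, hu, -⟩
  simp at hu

lemma image_val_bounds {ε : ℝ} (hε : 0 < ε) (S : Set (Box ε)) (v : ℤ × ℤ)
    (hv : v ∈ Subtype.val '' S) :
    0 ≤ v.1 ∧ v.1 ≤ boxSide ε ∧ 0 ≤ v.2 ∧ v.2 ≤ boxSide ε := by
  obtain ⟨w, -, rfl⟩ := hv
  exact (mem_Box_iff hε _).1 w.2

/-- The reflection of the box exchanging the coordinates. -/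
def swapBox {ε : ℝ} (v : Box ε) : Box ε := ⟨v.1.swap, v.2.2, v.2.1⟩

lemma toPlane_swapBox {ε : ℝ} (v : Box ε) : toPlane ε (swapBox v) = reflect (toPlane ε v) := rfl

/-- The Hex theorem on the box, with the bottom-top alternative turned by reflection into a
left-right crossing, so that both alternatives concern one monotone family. -/
lemma crossingSets_or {ε : ℝ} (hε : 0 < ε) (S T : Set (Box ε)) (hST : ∀ v, v ∈ S ∨ v ∈ T) :
    S ∈ crossingSets ε ∨ swapBox ⁻¹' T ∈ crossingSets ε := by
  rcases triCross_or_triCross_swap (boxSide ε) (Subtype.val '' S) (Subtype.val '' T)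
    (image_val_bounds hε S) (image_val_bounds hε T) (fun v h1 h2 h3 h4 => by
      have hv : v ∈ Box ε := (mem_Box_iff hε v).2 ⟨h1, h2, h3, h4⟩
      exact (hST ⟨v, hv⟩).imp (fun h => ⟨_, h, rfl⟩) fun h => ⟨_, h, rfl⟩) with h | h
  · exact Or.inl h
  · refine Or.inr (TriCross.mono h ?_)
    rintro v ⟨w, hw, hwv⟩
    exact ⟨swapBox w, hw, (congrArg Prod.swap hwv).trans (Prod.swap_swap v)⟩

lemma univ_mem_crossingSets {ε : ℝ} (hε : 0 < ε) : Set.univ ∈ crossingSets ε := by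
  rcases crossingSets_or hε Set.univ ∅ (by simp) with h | h
  · exact h
  · exact absurd h (empty_notMem_crossingSets ε)

/-! ### Lengths of lattice paths -/

lemma sum_map_le_of_nodup_subset {V : Type*} {l l' : List V} (hnd : l'.Nodup) (hsub : l' ⊆ l)
    {f : V → ℝ} (hf : ∀ v, 0 ≤ f v) : (l'.map f).sum ≤ (l.map f).sum := by
  obtain ⟨m, hm, hml⟩ := List.subperm_of_subset hnd hsub
  rw [← (hm.map f).sum_eq]
  exact (hml.map f).sum_le_sum fun a ha => by
    obtain ⟨v, -, rfl⟩ := List.mem_map.1 ha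
    exact hf v

lemma sum_map_sub_const {V : Type*} (l : List V) (f : V → ℝ) (c : ℝ) :
    (l.map fun v => f v - c).sum = (l.map f).sum - c * l.length := by
  induction l with
  | nil => simp
  | cons a l ih => simp only [List.map_cons, List.sum_cons, ih, List.length_cons]; push_cast; ring

/-- Were `l` longer than `l'`, subtracting the positive minimum of `f` from all weights would keep
them nonnegative and lower the sum over `l` by strictly more, contradicting the comparison of sums.
-/
lemma nodup_of_sum_map_le {V : Type*} [Finite V] {l l' : List V} (hnd : l'.Nodup)
    (hsub : l' ⊆ l) {f : V → ℝ} (hf : ∀ v, 0 < f v) (hle : (l.map f).sum ≤ (l'.map f).sum) :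
    l.Nodup := by
  have hsp := List.subperm_of_subset hnd hsub
  by_cases hlen : l.length ≤ l'.length
  · exact (hsp.perm_of_length_le hlen).nodup_iff.1 hnd
  exfalso
  push Not at hlen
  have : Nonempty V := by
    cases l with
    | nil => simp at hlen
    | cons a _ => exact ⟨a⟩
  obtain ⟨m, hm⟩ := Finite.exists_min f
  have h1 := sum_map_le_of_nodup_subset hnd hsub (f := fun v => f v - f m) fun v => by
    linarith [hm v]
  rw [sum_map_sub_const, sum_map_sub_const] at h1
  have h2 : (l'.length : ℝ) < l.length := by exact_mod_cast hlen
  nlinarith [hf m]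

section Length

variable {Ω : Type*} {h : Measure ℂ → Ω → ℝ} {ξ ε : ℝ} {ω : Ω}

/-- Puts the sum in the form indexed by vertices of type `Box ε`, to which the list lemmas apply. -/
lemma lfppLength_eq {z w : Box ε} (p : (boxGraph ε).Walk z w) :
    lfppLength h ξ ε ω p =
      (p.support.map fun v : Box ε => ε * Real.exp (ξ * circleAvg h ε (toPlane ε v) ω)).sum := by
  simp [lfppLength, ← List.map_eq_flatMap, Function.comp_def]

lemma lfppLength_nonneg (hε : 0 < ε) {z w : Box ε} (p : (boxGraph ε).Walk z w) :
    0 ≤ lfppLength h ξ ε ω p := by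
  rw [lfppLength_eq]
  exact List.sum_nonneg fun a ha => by
    obtain ⟨v, -, rfl⟩ := List.mem_map.1 ha
    positivity

lemma lfppDist_nonneg (hε : 0 < ε) (z w : Box ε) : 0 ≤ lfppDist h ξ ε ω z w :=
  Real.iInf_nonneg fun p => lfppLength_nonneg hε p

lemma crossingDist_le (hε : 0 < ε) {z w : Box ε} (hz : z ∈ leftBoundary ε)
    (hw : w ∈ rightBoundary ε) (p : (boxGraph ε).Walk z w) :
    crossingDist h ξ ε ω ≤ lfppLength h ξ ε ω p := by
  refine ciInf_le_of_le ⟨0, ?_⟩ ⟨z, hz⟩ (ciInf_le_of_le ⟨0, ?_⟩ ⟨w, hw⟩ (ciInf_le ⟨0, ?_⟩ p))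
  · rintro _ ⟨a, rfl⟩
    exact Real.iInf_nonneg fun b => lfppDist_nonneg hε _ _
  · rintro _ ⟨a, rfl⟩
    exact lfppDist_nonneg hε _ _
  · rintro _ ⟨a, rfl⟩
    exact lfppLength_nonneg hε _

lemma le_crossingDist (hε : 0 < ε) {c : ℝ}
    (hc : ∀ (z w : Box ε) (p : (boxGraph ε).Walk z w), c ≤ lfppLength h ξ ε ω p) :
    c ≤ crossingDist h ξ ε ω := by
  have := nonempty_leftBoundary hε
  have := nonempty_rightBoundary hε
  refine le_ciInf fun z => le_ciInf fun w => ?_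
  have : Nonempty ((boxGraph ε).Walk z.1 w.1) := boxGraph_preconnected hε _ _
  exact le_ciInf fun p => hc _ _ p

lemma exists_walk_of_crossingDist_lt (hε : 0 < ε) {c : ℝ} (hc : crossingDist h ξ ε ω < c) :
    ∃ (z w : Box ε) (p : (boxGraph ε).Walk z w), lfppLength h ξ ε ω p < c := by
  have := nonempty_leftBoundary hε
  have := nonempty_rightBoundary hε
  obtain ⟨z, hz⟩ := exists_lt_of_ciInf_lt hc
  obtain ⟨w, hw⟩ := exists_lt_of_ciInf_lt hz
  have : Nonempty ((boxGraph ε).Walk z.1 w.1) := boxGraph_preconnected hε _ _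
  obtain ⟨p, hp⟩ := exists_lt_of_ciInf_lt hw
  exact ⟨_, _, p, hp⟩

open Classical in
lemma lfppLength_bypass_le (hε : 0 < ε) {z w : Box ε} (p : (boxGraph ε).Walk z w) :
    lfppLength h ξ ε ω p.bypass ≤ lfppLength h ξ ε ω p := by
  rw [lfppLength_eq, lfppLength_eq]
  exact sum_map_le_of_nodup_subset p.bypass_isPath.support_nodup p.support_bypass_subset_support
    fun v => by positivity

open Classical in
-- Vertex weights are positive, so erasing a loop would strictly shorten a geodesic.
lemma IsCrossingGeodesic.isPath (hε : 0 < ε) {z w : Box ε} {p : (boxGraph ε).Walk z w}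
    (hp : IsCrossingGeodesic h ξ ε ω p) : p.IsPath := by
  have := finite_Box hε
  rw [SimpleGraph.Walk.isPath_def]
  refine nodup_of_sum_map_le p.bypass_isPath.support_nodup p.support_bypass_subset_support
    (f := fun v => ε * Real.exp (ξ * circleAvg h ε (toPlane ε v) ω)) (fun v => by positivity) ?_
  have h1 := crossingDist_le (h := h) (ξ := ξ) (ω := ω) hε hp.1 hp.2.1 p.bypass
  rw [← hp.2.2] at h1
  rwa [lfppLength_eq, lfppLength_eq] at h1

lemma numVertices_pos {z w : Box ε} (p : (boxGraph ε).Walk z w) : 1 ≤ numVertices p := by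
  rw [numVertices, SimpleGraph.Walk.length_support]
  omega

end Length

/-- A crude volume bound: after loop erasure there are at most `4 / ε ^ 2` vertices, each of weight
at most `ε * exp (2 * ξ * d)`. One `d` is the level of the crossing, the other pays for the diagonal
detours. -/
lemma crossingDist_le_of_crossing {Ω : Type*} {h : Measure ℂ → Ω → ℝ} {ε : ℝ} (hε : 0 < ε) (hε1 : ε ≤ 1) {ξ : ℝ} (hξ : 0 ≤ ξ) {d : ℝ}
    (hd : 0 ≤ d) {ω : Ω}
    (hcross : {v : Box ε | circleAvg h ε (toPlane ε v) ω ≤ d} ∈ crossingSets ε)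
    (hinc : ∀ v w : Box ε, w.1 = (v.1.1 + 1, v.1.2) →
      circleAvg h ε (toPlane ε w) ω - circleAvg h ε (toPlane ε v) ω ≤ d) :
    crossingDist h ξ ε ω ≤ 4 / ε * exp (2 * ξ * d) := by
  classical
  have := finite_Box hε
  have := Fintype.ofFinite (Box ε)
  obtain ⟨u, ⟨u', hu', rfl⟩, v, hu0, hvn, hr⟩ := hcross
  obtain ⟨w, rfl, -, p, hp⟩ := exists_walk_of_triReach hε
    (x := fun v : Box ε => circleAvg h ε (toPlane ε v) ω) hd hinc u' hu' hr
  refine (crossingDist_le hε (mem_leftBoundary hε hu0) (mem_rightBoundary hε hvn) p.bypass).trans ?_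
  rw [lfppLength_eq, ← List.sum_toFinset _ p.bypass_isPath.support_nodup]
  have hcard : (p.bypass.support.toFinset.card : ℝ) ≤ 4 / ε ^ 2 := by
    refine le_trans ?_ (card_Box_le hε hε1)
    rw [Nat.card_eq_fintype_card]
    exact_mod_cast Finset.card_le_univ _
  calc ∑ v ∈ p.bypass.support.toFinset, ε * exp (ξ * circleAvg h ε (toPlane ε v) ω)
      ≤ ∑ _v ∈ p.bypass.support.toFinset, ε * exp (ξ * (d + d)) := by
        refine Finset.sum_le_sum fun v hv => ?_
        have := hp v (p.support_bypass_subset_support (List.mem_toFinset.1 hv))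
        gcongr
    _ = p.bypass.support.toFinset.card * (ε * exp (ξ * (d + d))) := by
        rw [Finset.sum_const, nsmul_eq_mul]
    _ ≤ 4 / ε ^ 2 * (ε * exp (ξ * (d + d))) := by gcongr
    _ = 4 / ε * exp (2 * ξ * d) := by
        rw [show ξ * (d + d) = 2 * ξ * d by ring]
        field_simp

/-! ### Tail estimates for the circle averages on the lattice -/

section Tails

variable {Ω : Type*} [MeasurableSpace Ω] {P : Measure Ω} {h : Measure ℂ → Ω → ℝ} {ε : ℝ}

lemma IsWholePlaneGFF.variance_le (hh : IsWholePlaneGFF h P) (hε : 0 < ε) (hε1 : ε ≤ 1)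
    (v : Box ε) : Var[circleAvg h ε (toPlane ε v); P] ≤ -Real.log ε + 4 := by
  rw [hh.variance_circleAvg _ hε]
  have := posLogAvg_le hε.le (show ‖toPlane ε v‖ + ε ≤ 3 by linarith [norm_toPlane_le v])
  linarith

lemma IsWholePlaneGFF.measure_le_neg_le (hh : IsWholePlaneGFF h P) (hε : 0 < ε) (hε1 : ε ≤ 1)
    (v : Box ε) {t : ℝ} (ht : 0 ≤ t) :
    P {ω | circleAvg h ε (toPlane ε v) ω ≤ -t} ≤
      ENNReal.ofReal (exp (-t ^ 2 / (2 * (-Real.log ε + 4)))) := by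
  have hlog := Real.log_nonpos hε.le hε1
  have hX := hh.law_circleAvg (toPlane ε v) hε
  have h1 := measure_ge_le_of_hasGaussianLaw (X := fun ω => -circleAvg h ε (toPlane ε v) ω)
    hX.fun_neg (by rw [integral_neg, hh.integral_circleAvg _ hε, neg_zero])
    (s := -Real.log ε + 4) (by
      have : (fun ω => -circleAvg h ε (toPlane ε v) ω) = -circleAvg h ε (toPlane ε v) := rfl
      rw [this, variance_neg]
      exact hh.variance_le hε hε1 v) (by linarith) ht
  simpa only [le_neg] using h1

lemma measure_iUnion_box_le (hε : 0 < ε) (hε1 : ε ≤ 1) (s : Box ε → Set Ω) {c : ℝ} (hc : 0 ≤ c)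
    (hs : ∀ v, P (s v) ≤ ENNReal.ofReal c) :
    P (⋃ v, s v) ≤ ENNReal.ofReal (4 / ε ^ 2 * c) := by
  have := finite_Box hε
  have := Fintype.ofFinite (Box ε)
  calc P (⋃ v, s v) ≤ ∑ v, P (s v) := measure_iUnion_fintype_le _ _
    _ ≤ ∑ _ : Box ε, ENNReal.ofReal c := Finset.sum_le_sum fun v _ => hs v
    _ = ENNReal.ofReal (Nat.card (Box ε) * c) := by
        rw [Finset.sum_const, Finset.card_univ, nsmul_eq_mul, Nat.card_eq_fintype_card,
          ENNReal.ofReal_mul (by positivity), ENNReal.ofReal_natCast]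
    _ ≤ ENNReal.ofReal (4 / ε ^ 2 * c) :=
        ENNReal.ofReal_le_ofReal (mul_le_mul_of_nonneg_right (card_Box_le hε hε1) hc)

lemma IsWholePlaneGFF.measure_exists_le_neg_le (hh : IsWholePlaneGFF h P) (hε : 0 < ε)
    (hε1 : ε ≤ 1) {t : ℝ} (ht : 0 ≤ t) :
    P {ω | ∃ v : Box ε, circleAvg h ε (toPlane ε v) ω ≤ -t} ≤
      ENNReal.ofReal (4 / ε ^ 2 * exp (-t ^ 2 / (2 * (-Real.log ε + 4)))) := by
  rw [Set.ofPred_exists]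
  exact measure_iUnion_box_le hε hε1 _ (exp_pos _).le fun v => hh.measure_le_neg_le hε hε1 v ht

/-- The right neighbour is determined by `v`, so the union bound runs over single vertices; the
increment has variance at most `2`. -/
lemma IsWholePlaneGFF.measure_exists_increment_le (hh : IsWholePlaneGFF h P) (hε : 0 < ε)
    (hε1 : ε ≤ 1) {d : ℝ} (hd : 0 ≤ d) :
    P {ω | ∃ v w : Box ε, w.1 = (v.1.1 + 1, v.1.2) ∧
      d ≤ circleAvg h ε (toPlane ε w) ω - circleAvg h ε (toPlane ε v) ω} ≤
      ENNReal.ofReal (4 / ε ^ 2 * exp (-d ^ 2 / (2 * 2))) := by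
  rw [Set.ofPred_exists]
  refine measure_iUnion_box_le hε hε1 _ (exp_pos _).le fun v => ?_
  by_cases hv : (v.1.1 + 1, v.1.2) ∈ Box ε
  · set w : Box ε := ⟨(v.1.1 + 1, v.1.2), hv⟩ with hw
    have hX := hh.law_sub_circleAvg (toPlane ε w) (toPlane ε v) hε
    have hdist : ‖toPlane ε w - toPlane ε v‖ ≤ ε := by
      have : toPlane ε w - toPlane ε v = (ε : ℂ) := by
        apply Complex.ext
        · simp [toPlane, hw]; ring
        · simp [toPlane, hw]
      rw [this, Complex.norm_real, Real.norm_of_nonneg hε.le]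
    have h1 := measure_ge_le_of_hasGaussianLaw hX (by
      rw [integral_sub (hh.law_circleAvg _ hε).integrable (hh.law_circleAvg _ hε).integrable,
        hh.integral_circleAvg _ hε, hh.integral_circleAvg _ hε, sub_zero]) (s := 2) (by
      rw [hh.variance_sub_circleAvg _ _ hε]
      linarith [interaction_le hε hdist]) (by norm_num) hd
    refine (measure_mono ?_).trans h1
    rintro ω ⟨w', hw', hd'⟩
    have : w' = w := Subtype.ext hw'
    rw [this] at hd'
    exact hd'
  · have : {ω | ∃ w : Box ε, w.1 = (v.1.1 + 1, v.1.2) ∧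
        d ≤ circleAvg h ε (toPlane ε w) ω - circleAvg h ε (toPlane ε v) ω} = ∅ := by
      refine Set.eq_empty_of_forall_notMem ?_
      rintro ω ⟨w, hw, -⟩
      exact hv (hw ▸ w.2)
    rw [this]
    simp

/-- With high probability, the set where the field is at most `d` contains a left-right
crossing along the triangular lattice. -/
lemma IsWholePlaneGFF.measure_not_crossing_le [IsProbabilityMeasure P]
    (hh : IsWholePlaneGFF h P) (hε : 0 < ε)
    (hε1 : ε ≤ 1) {d : ℝ} (hd : 1 < d) :
    P {ω | {v : Box ε | circleAvg h ε (toPlane ε v) ω ≤ d} ∉ crossingSets ε} ≤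
      ENNReal.ofReal (2 * ((π / 2) ^ 2 * (-Real.log ε + 4)) / (d - 1) ^ 2) := by
  have := finite_Box hε
  have := Fintype.ofFinite (Box ε)
  set X : Ω → Box ε → ℝ := fun ω v => circleAvg h ε (toPlane ε v) ω with hXdef
  have hX : HasGaussianLaw X P := hh.hasGaussianLaw_circleAvg (fun v : Box ε => toPlane ε v) hε
  set μ := P.map X with hμ
  have hG : IsGaussian μ := hX.isGaussian_map
  have hproj : ∀ v : Box ε, AEStronglyMeasurable (fun x : Box ε → ℝ => x v) μ := fun v =>
    (continuous_apply v).aestronglyMeasurable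
  have hX0 : ∀ v, ∫ ω, X ω v ∂P = 0 := fun v => hh.integral_circleAvg _ hε
  have hmean : μ[id] = 0 := by
    ext v
    have e := (ContinuousLinearMap.proj (R := ℝ) (φ := fun _ : Box ε => ℝ) v).integral_comp_id_comm'
      (μ := μ) IsGaussian.integrable_id
    simp only [ContinuousLinearMap.proj_apply] at e
    rw [← e, hμ, integral_map hX.aemeasurable (hproj v)]
    exact hX0 v
  have hs : ∀ v, ∫ x, (x v) ^ 2 ∂μ ≤ -Real.log ε + 4 := fun v => by
    have e := integral_map hX.aemeasurable (f := fun x : Box ε → ℝ => (x v) ^ 2) ((hproj v).pow 2)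
    rw [hμ, e]
    refine le_trans (le_of_eq ?_) (hh.variance_le hε hε1 v)
    rw [variance_of_integral_eq_zero (hh.law_circleAvg _ hε).aemeasurable
      (hh.integral_circleAvg _ hε)]
  set F := minimaxLevel (crossingSets ε) with hFdef
  have hF : IsMinimax F := isMinimax_minimaxLevel (crossingSets_mono ε) (univ_mem_crossingSets hε)
    (empty_notMem_crossingSets ε)
  have hFle : ∀ x t, {v | x v ≤ t} ∈ crossingSets ε → F x ≤ t := fun x t ht =>
    minimaxLevel_le (crossingSets_mono ε) (univ_mem_crossingSets hε)
      (empty_notMem_crossingSets ε) ht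
  -- invariance under reflection and change of sign
  let T : (Box ε → ℝ) →L[ℝ] (Box ε → ℝ) := ContinuousLinearMap.pi fun v =>
    -ContinuousLinearMap.proj (R := ℝ) (φ := fun _ : Box ε => ℝ) (swapBox v)
  have hT : ∀ x v, T x v = -x (swapBox v) := fun x v => rfl
  have hTμ : μ.map T = μ := by
    rw [hμ, AEMeasurable.map_map_of_aemeasurable T.measurable.aemeasurable hX.aemeasurable]
    refine map_eq_map_of_cov_eq (hX.map T) hX (fun v => ?_) hX0 fun u v => ?_
    · simp only [Function.comp_apply, hT]
      rw [integral_neg, hX0, neg_zero]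
    · simp only [Function.comp_apply, hT]
      rw [covariance_fun_neg_left, covariance_fun_neg_right, neg_neg]
      refine (hh.cov_circleAvg _ _ hε).trans (Eq.trans ?_ (hh.cov_circleAvg _ _ hε).symm)
      rw [toPlane_swapBox, toPlane_swapBox, posLogAvg_reflect, posLogAvg_reflect,
        interaction_reflect]
  have hmeasA : MeasurableSet {x | F x ≤ 0} :=
    measurableSet_le hF.continuous.measurable measurable_const
  have hhalf : 1 / 2 ≤ μ.real {x | F x ≤ 0} := by
    -- The Hex theorem for `{x ≤ 0}` and `{-x ≤ 0}`: either `x` or its image under `T` has a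
    -- crossing at level `0`, and the two events have equal probability.
    have hcover : Set.univ ⊆ {x | F x ≤ 0} ∪ T ⁻¹' {x | F x ≤ 0} := by
      intro x _
      rcases crossingSets_or hε {v | x v ≤ 0} {v | -x v ≤ 0} (fun v => by
        simp only [Set.mem_ofPred_eq]
        rcases le_total (x v) 0 with h | h
        · exact Or.inl h
        · exact Or.inr (by linarith)) with h | h
      · exact Or.inl (hFle x 0 h)
      · exact Or.inr (hFle (T x) 0 h)
    have h1 := (measureReal_mono (μ := μ) hcover).trans (measureReal_union_le _ _)
    have h2 : μ.real (T ⁻¹' {x | F x ≤ 0}) = μ.real {x | F x ≤ 0} := by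
      rw [← map_measureReal_apply T.measurable hmeasA, hTμ]
    rw [h2, probReal_univ] at h1
    linarith
  have hmain := hF.measureReal_gt_le hmean hs hhalf hd
  have hmeasB : MeasurableSet {x | d < F x} :=
    measurableSet_lt measurable_const hF.continuous.measurable
  calc P {ω | {v : Box ε | circleAvg h ε (toPlane ε v) ω ≤ d} ∉ crossingSets ε}
      ≤ P (X ⁻¹' {x | d < F x}) := by
        refine measure_mono fun ω hω => ?_
        simp only [Set.mem_preimage, Set.mem_ofPred_eq] at hω ⊢
        by_contra hcon
        rw [not_lt] at hcon
        refine hω (crossingSets_mono ε _ _ (fun v hv => ?_) (minimaxLevel_mem (crossingSets_mono ε)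
          (univ_mem_crossingSets hε) (empty_notMem_crossingSets ε) (X ω)))
        exact le_trans hv hcon
    _ = μ {x | d < F x} := (Measure.map_apply_of_aemeasurable hX.aemeasurable hmeasB).symm
    _ = ENNReal.ofReal (μ.real {x | d < F x}) := (ofReal_measureReal (by finiteness)).symm
    _ ≤ _ := ENNReal.ofReal_le_ofReal hmain

lemma IsWholePlaneGFF.measure_crossingDist_gt_le [IsProbabilityMeasure P]
    (hh : IsWholePlaneGFF h P) (hε : 0 < ε) (hε1 : ε ≤ 1) {ξ : ℝ} (hξ : 0 ≤ ξ) {d : ℝ}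
    (hd : 1 < d) :
    P {ω | ¬ crossingDist h ξ ε ω ≤ 4 / ε * exp (2 * ξ * d)} ≤
      ENNReal.ofReal (2 * ((π / 2) ^ 2 * (-Real.log ε + 4)) / (d - 1) ^ 2 +
        4 / ε ^ 2 * exp (-d ^ 2 / (2 * 2))) := by
  have hlog := Real.log_nonpos hε.le hε1
  have hd0 : 0 ≤ d := by linarith
  rw [ENNReal.ofReal_add (div_nonneg (mul_nonneg zero_le_two (mul_nonneg (sq_nonneg _)
    (by linarith))) (sq_nonneg _)) (by positivity)]
  refine le_trans (measure_mono ?_) ((measure_union_le _ _).trans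
    (add_le_add (hh.measure_not_crossing_le hε hε1 hd)
      (hh.measure_exists_increment_le hε hε1 hd0)))
  intro ω hω
  by_contra hcon
  simp only [Set.mem_union, Set.mem_ofPred_eq, not_or, not_not, not_exists, not_and, not_le] at hcon
  exact hω (crossingDist_le_of_crossing hε hε1 hξ hd0 hcon.1 fun v w hvw => (hcon.2 v w hvw).le)

end Tails

/-! ### The distance exponent -/

lemma tendsto_neg_log_nhdsGT_zero : Tendsto (fun ε : ℝ => -Real.log ε) (𝓝[>] 0) atTop :=
  tendsto_neg_atBot_atTop.comp tendsto_log_nhdsGT_zero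

lemma eventually_mem_Ioc : ∀ᶠ ε : ℝ in 𝓝[>] 0, 0 < ε ∧ ε ≤ 1 := by
  filter_upwards [Ioc_mem_nhdsGT (zero_lt_one' ℝ)] with ε hε using hε

lemma tendsto_rpow_nhdsGT_zero {s : ℝ} (hs : 0 < s) :
    Tendsto (fun ε : ℝ => ε ^ s) (𝓝[>] 0) (𝓝 0) := by
  have h := (Real.continuousAt_rpow_const 0 s (Or.inr hs.le)).tendsto
  rw [Real.zero_rpow hs.ne'] at h
  exact h.mono_left nhdsWithin_le_nhds

lemma eventually_const_mul_rpow_le (K : ℝ) {s : ℝ} (hs : 0 < s) :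
    ∀ᶠ ε : ℝ in 𝓝[>] 0, K * ε ^ s ≤ 1 := by
  have h := (tendsto_rpow_nhdsGT_zero hs).const_mul K
  rw [mul_zero] at h
  exact h.eventually_le_const one_pos

lemma rpow_eq_exp_neg_log {ε : ℝ} (hε : 0 < ε) (s : ℝ) : ε ^ s = exp (-s * -Real.log ε) := by
  rw [Real.rpow_def_of_pos hε]
  ring_nf

lemma le_lfppLength_of_forall_le {Ω : Type*} {h : Measure ℂ → Ω → ℝ} {ξ ε : ℝ} (hε : 0 < ε) (hξ : 0 ≤ ξ) {t : ℝ} {ω : Ω}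
    (ht : ∀ v : Box ε, -t ≤ circleAvg h ε (toPlane ε v) ω) {z w : Box ε}
    (p : (boxGraph ε).Walk z w) : ε * exp (-ξ * t) ≤ lfppLength h ξ ε ω p := by
  rw [lfppLength_eq]
  refine le_trans ?_ (List.single_le_sum (fun a ha => ?_) _
    (List.mem_map.2 ⟨z, p.start_mem_support, rfl⟩))
  · have := ht z
    refine mul_le_mul_of_nonneg_left (Real.exp_le_exp.2 ?_) hε.le
    nlinarith
  · obtain ⟨v, -, rfl⟩ := List.mem_map.1 ha
    positivity

section Prob

variable {Ω : Type*} [MeasurableSpace Ω] {P : Measure Ω}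

lemma tendsto_measure_one_of_compl_le [IsProbabilityMeasure P] {l : Filter ℝ} {E : ℝ → Set Ω}
    {b : ℝ → ℝ} (hE : ∀ᶠ ε in l, P (E ε)ᶜ ≤ ENNReal.ofReal (b ε)) (hb : Tendsto b l (𝓝 0)) :
    Tendsto (fun ε => P (E ε)) l (𝓝 1) := by
  have h1 : Tendsto (fun ε => 1 - ENNReal.ofReal (b ε)) l (𝓝 1) := by
    have := ENNReal.Tendsto.sub (tendsto_const_nhds (x := (1 : ENNReal)) (f := l))
      (ENNReal.tendsto_ofReal hb) (Or.inl ENNReal.one_ne_top)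
    simpa using this
  refine tendsto_of_tendsto_of_tendsto_of_le_of_le' h1 tendsto_const_nhds ?_
    (Eventually.of_forall fun ε => prob_le_one)
  filter_upwards [hE] with ε hε
  rw [tsub_le_iff_right]
  calc (1 : ENNReal) = P (E ε ∪ (E ε)ᶜ) := by rw [Set.union_compl_self, measure_univ]
    _ ≤ P (E ε) + P (E ε)ᶜ := measure_union_le _ _
    _ ≤ _ := by gcongr

lemma tendsto_measure_one_of_subset [IsProbabilityMeasure P] {l : Filter ℝ} {E F : ℝ → Set Ω}
    (hE : Tendsto (fun ε => P (E ε)) l (𝓝 1)) (hEF : ∀ᶠ ε in l, E ε ⊆ F ε) :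
    Tendsto (fun ε => P (F ε)) l (𝓝 1) :=
  tendsto_of_tendsto_of_tendsto_of_le_of_le' hE tendsto_const_nhds
    (hEF.mono fun _ h => measure_mono h) (Eventually.of_forall fun _ => prob_le_one)

/-- No measurability is needed to intersect an event of probability tending to one with one whose
complement has probability tending to zero. -/
lemma tendsto_measure_one_of_inter_compl_le [IsProbabilityMeasure P] {l : Filter ℝ}
    {E G F : ℝ → Set Ω} {b : ℝ → ℝ} (hE : Tendsto (fun ε => P (E ε)) l (𝓝 1))
    (hG : ∀ᶠ ε in l, P (G ε)ᶜ ≤ ENNReal.ofReal (b ε)) (hb : Tendsto b l (𝓝 0))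
    (hEF : ∀ᶠ ε in l, E ε ∩ G ε ⊆ F ε) : Tendsto (fun ε => P (F ε)) l (𝓝 1) := by
  have h1 : Tendsto (fun ε => P (E ε) - ENNReal.ofReal (b ε)) l (𝓝 1) := by
    have := ENNReal.Tendsto.sub hE (ENNReal.tendsto_ofReal hb) (Or.inl ENNReal.one_ne_top)
    simpa using this
  refine tendsto_of_tendsto_of_tendsto_of_le_of_le' h1 tendsto_const_nhds ?_
    (Eventually.of_forall fun ε => prob_le_one)
  filter_upwards [hG, hEF] with ε hε hsub
  rw [tsub_le_iff_right]
  calc P (E ε) ≤ P ((E ε ∩ G ε) ∪ (G ε)ᶜ) := measure_mono fun ω hω => by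
        by_cases h : ω ∈ G ε
        · exact Or.inl ⟨hω, h⟩
        · exact Or.inr h
    _ ≤ P (E ε ∩ G ε) + P (G ε)ᶜ := measure_union_le _ _
    _ ≤ _ := by gcongr

lemma tendsto_one_of_liminf_eq_one [IsProbabilityMeasure P] {E : ℝ → Set Ω}
    (hE : liminf (fun ε => P (E ε)) (𝓝[>] (0 : ℝ)) = 1) :
    Tendsto (fun ε => P (E ε)) (𝓝[>] 0) (𝓝 1) := by
  refine tendsto_of_le_liminf_of_limsup_le hE.ge ?_
  exact (limsup_le_limsup (Eventually.of_forall fun ε => prob_le_one)).trans (by simp)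

variable [IsProbabilityMeasure P] {h : Measure ℂ → Ω → ℝ} {ξ : ℝ}

/-- The left-right distance is at most `ε^(-1-κ)` with high probability. -/
lemma IsWholePlaneGFF.tendsto_crossingDist_le (hh : IsWholePlaneGFF h P) (hξ : 0 < ξ) {κ : ℝ}
    (hκ : 0 < κ) :
    Tendsto (fun ε => P {ω | crossingDist h ξ ε ω ≤ ε ^ (-1 - κ)}) (𝓝[>] 0) (𝓝 1) := by
  -- With `d = δ L` the factor `exp (2 * ξ * d)` is `ε ^ (-(κ / 2))`; the other half of `κ` absorbs
  -- the constant `4`.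
  set δ : ℝ := κ / (4 * ξ) with hδ
  have hδ0 : 0 < δ := by positivity
  refine tendsto_measure_one_of_compl_le
    (b := fun ε => 4 * π ^ 2 / δ ^ 2 * (-Real.log ε)⁻¹ + 4 * ε ^ (1 : ℝ)) ?_ ?_
  · filter_upwards [eventually_mem_Ioc, eventually_const_mul_rpow_le 4 (half_pos hκ),
      tendsto_neg_log_nhdsGT_zero.eventually_ge_atTop 4,
      tendsto_neg_log_nhdsGT_zero.eventually_ge_atTop (2 / δ),
      -- From this threshold on `(δ L)² / 4 ≥ 3 L`: the increment tail beats the `ε ^ (-2)` of the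
      -- union bound with a factor `ε` to spare.
      tendsto_neg_log_nhdsGT_zero.eventually_ge_atTop (12 / δ ^ 2)] with ε ⟨hε, hε1⟩ h4 hL4 hL2 hL12
    set L := -Real.log ε with hL
    have hL0 : 0 < L := by linarith
    have hLδ : 2 ≤ δ * L := by rwa [div_le_iff₀' hδ0] at hL2
    have hεL : ε = exp (-L) := by rw [hL, neg_neg, Real.exp_log hε]
    have hb := hh.measure_crossingDist_gt_le hε hε1 hξ.le (d := δ * L) (by linarith)
    have hsub : {ω | crossingDist h ξ ε ω ≤ ε ^ (-1 - κ)}ᶜ ⊆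
        {ω | ¬ crossingDist h ξ ε ω ≤ 4 / ε * exp (2 * ξ * (δ * L))} := by
      intro ω hω hle
      refine hω (hle.trans ?_)
      have e1 : exp (2 * ξ * (δ * L)) = ε ^ (-(κ / 2)) := by
        rw [rpow_eq_exp_neg_log hε, hδ]
        congr 1
        field_simp
        ring
      have e2 : ε ^ (-1 - κ) = ε⁻¹ * (ε ^ (-(κ / 2)) * ε ^ (-(κ / 2))) := by
        rw [← Real.rpow_neg_one, ← Real.rpow_add hε, ← Real.rpow_add hε]
        congr 1; ring
      have e3 : 4 ≤ ε ^ (-(κ / 2)) := by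
        rw [Real.rpow_neg hε.le, ← one_div, le_div_iff₀ (Real.rpow_pos_of_pos hε _)]
        exact h4
      rw [e1, e2, div_eq_mul_inv]
      have : 0 < ε ^ (-(κ / 2)) := Real.rpow_pos_of_pos hε _
      have hi : 0 < ε⁻¹ := by positivity
      calc 4 * ε⁻¹ * ε ^ (-(κ / 2)) = ε⁻¹ * (4 * ε ^ (-(κ / 2))) := by ring
        _ ≤ _ := by gcongr
    refine (measure_mono hsub).trans (hb.trans (ENNReal.ofReal_le_ofReal (add_le_add ?_ ?_)))
    · rw [← hL]
      have h1 : (δ * L / 2) ^ 2 ≤ (δ * L - 1) ^ 2 := by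
        apply pow_le_pow_left₀ (by positivity); linarith
      calc 2 * ((π / 2) ^ 2 * (L + 4)) / (δ * L - 1) ^ 2
          ≤ 2 * ((π / 2) ^ 2 * (L + L)) / (δ * L / 2) ^ 2 := by gcongr
        _ = 4 * π ^ 2 / δ ^ 2 * L⁻¹ := by field_simp; ring
    · rw [Real.rpow_one, div_mul_eq_mul_div, mul_div_assoc]
      refine mul_le_mul_of_nonneg_left ?_ (by norm_num)
      rw [hεL, ← Real.exp_nat_mul, ← Real.exp_sub, Real.exp_le_exp]
      have h12 : 12 ≤ δ ^ 2 * L := by rwa [div_le_iff₀' (by positivity)] at hL12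
      push_cast
      nlinarith
  · have h1 : Tendsto (fun ε : ℝ => (-Real.log ε)⁻¹) (𝓝[>] 0) (𝓝 0) :=
      tendsto_inv_atTop_zero.comp tendsto_neg_log_nhdsGT_zero
    simpa using (h1.const_mul (4 * π ^ 2 / δ ^ 2)).add
      ((tendsto_rpow_nhdsGT_zero one_pos).const_mul 4)

/-- The left-right distance is at least a power of `ε` with high probability. -/
lemma IsWholePlaneGFF.liminf_crossingDist_le_ne_one (hh : IsWholePlaneGFF h P) (hξ : 0 < ξ)
    {α : ℝ} (hα : 1 + 4 * ξ < α) :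
    liminf (fun ε => P {ω | crossingDist h ξ ε ω ≤ ε ^ α}) (𝓝[>] 0) ≠ 1 := by
  intro hlim
  have h1 := tendsto_one_of_liminf_eq_one hlim
  have h0 : Tendsto (fun ε => P {ω | crossingDist h ξ ε ω ≤ ε ^ α}) (𝓝[>] 0) (𝓝 0) := by
    have hb : Tendsto (fun ε : ℝ => ENNReal.ofReal (4 * ε ^ (2 : ℝ))) (𝓝[>] 0) (𝓝 0) := by
      have := ENNReal.tendsto_ofReal ((tendsto_rpow_nhdsGT_zero two_pos).const_mul 4)
      simpa using this
    refine tendsto_of_tendsto_of_tendsto_of_le_of_le' tendsto_const_nhds hb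
      (Eventually.of_forall fun _ => zero_le) ?_
    filter_upwards [eventually_mem_Ioc, tendsto_neg_log_nhdsGT_zero.eventually_ge_atTop 4]
      with ε ⟨hε, hε1⟩ hL4
    set L := -Real.log ε with hL
    have hL0 : 0 < L := by linarith
    have hεL : ε = exp (-L) := by rw [hL, neg_neg, Real.exp_log hε]
    -- At depth `4 L` with `L ≥ 4` one vertex has probability at most `ε ^ 4`, which beats the `4 /
    -- ε ^ 2` vertices.
    have hb := hh.measure_exists_le_neg_le hε hε1 (t := 4 * L) (by linarith)
    refine (measure_mono ?_).trans (hb.trans (ENNReal.ofReal_le_ofReal ?_))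
    · intro ω hω
      by_contra hcon
      simp only [Set.mem_ofPred_eq, not_exists, not_le] at hcon hω
      have h2 := le_crossingDist (h := h) (ξ := ξ) (ω := ω) hε fun z w p =>
        le_lfppLength_of_forall_le hε hξ.le (fun v => (hcon v).le) p
      have h3 : ε * exp (-ξ * (4 * L)) = ε ^ (1 + 4 * ξ) := by
        rw [rpow_eq_exp_neg_log hε, ← hL]
        nth_rewrite 1 [hεL]
        rw [← Real.exp_add]
        congr 1; ring
      rw [h3] at h2
      have h4 : ε ^ α < ε ^ (1 + 4 * ξ) := by
        rw [rpow_eq_exp_neg_log hε, rpow_eq_exp_neg_log hε, Real.exp_lt_exp, ← hL]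
        nlinarith
      linarith
    · rw [div_mul_eq_mul_div, mul_div_assoc, ← hL, rpow_eq_exp_neg_log hε, ← hL]
      refine mul_le_mul_of_nonneg_left ?_ (by norm_num)
      nth_rewrite 1 [hεL]
      rw [← Real.exp_nat_mul, ← Real.exp_sub, Real.exp_le_exp]
      have h5 : -(4 * L) ^ 2 / (2 * (L + 4)) ≤ -(4 * L) := by
        rw [div_le_iff₀ (by linarith)]
        nlinarith
      push_cast
      linarith
  exact zero_ne_one (tendsto_nhds_unique h0 h1)

/-- Makes `distExponent` a genuine supremum; for an unbounded set `sSup` would be the default `0`.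
-/
lemma IsWholePlaneGFF.bddAbove_exponents (hh : IsWholePlaneGFF h P) (hξ : 0 < ξ) :
    BddAbove {α : ℝ | liminf (fun ε : ℝ => P {ω | crossingDist h ξ ε ω ≤ ε ^ α}) (𝓝[>] 0) = 1} :=
  ⟨1 + 4 * ξ, fun α hα => by
    by_contra hcon
    exact hh.liminf_crossingDist_le_ne_one hξ (not_le.1 hcon) hα⟩

lemma IsWholePlaneGFF.neg_one_le_distExponent (hh : IsWholePlaneGFF h P) (hξ : 0 < ξ) :
    -1 ≤ distExponent h P ξ := by
  refine le_of_forall_pos_sub_le fun κ hκ => ?_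
  exact le_csSup (hh.bddAbove_exponents hξ) (hh.tendsto_crossingDist_le hξ hκ).liminf_eq

lemma IsWholePlaneGFF.tendsto_crossingDist_le_distExponent (hh : IsWholePlaneGFF h P)
    (hξ : 0 < ξ) {ζ : ℝ} (hζ : 0 < ζ) :
    Tendsto (fun ε => P {ω | crossingDist h ξ ε ω ≤ ε ^ (distExponent h P ξ - ζ)})
      (𝓝[>] 0) (𝓝 1) := by
  obtain ⟨α, hα, hlt⟩ := exists_lt_of_lt_csSup
    ⟨-1 - 1, (hh.tendsto_crossingDist_le hξ one_pos).liminf_eq⟩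
    (show distExponent h P ξ - ζ < distExponent h P ξ by linarith)
  refine tendsto_measure_one_of_subset (tendsto_one_of_liminf_eq_one hα) ?_
  filter_upwards [eventually_mem_Ioc] with ε ⟨hε, hε1⟩ ω hω
  exact le_trans hω (Real.rpow_le_rpow_of_exponent_ge hε hε1 hlt.le)

end Prob

/-! ### Counting vertices of short paths -/

/-- The number of vertices of the box where the field is at most `t`. -/
def lowCount {Ω : Type*} (h : Measure ℂ → Ω → ℝ) (ε t : ℝ) (ω : Ω) : ℕ :=
  {v : Box ε | circleAvg h ε (toPlane ε v) ω ≤ t}.ncard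

/-- A simple path has few vertices of low field value since there are few such vertices, and few
vertices of high field value since each of them contributes to its length. -/
lemma numVertices_le {Ω : Type*} {h : Measure ℂ → Ω → ℝ} {ξ ε : ℝ} (hε : 0 < ε) (hξ : 0 ≤ ξ)
    (t : ℝ) {ω : Ω} {z w : Box ε} {p : (boxGraph ε).Walk z w} (hp : p.IsPath) :
    (numVertices p : ℝ) ≤ lowCount h ε t ω + lfppLength h ξ ε ω p / (ε * exp (ξ * t)) := by
  classical
  have := finite_Box hε
  have := Fintype.ofFinite (Box ε)
  set X : Box ε → ℝ := fun v => circleAvg h ε (toPlane ε v) ω with hX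
  have hnd := hp.support_nodup
  have hlow : lowCount h ε t ω = (Finset.univ.filter fun v : Box ε => X v ≤ t).card := by
    rw [lowCount, ← Set.ncard_coe_finset]
    congr 1
    ext v
    simp [hX]
  have hsplit := Finset.card_filter_add_card_filter_not (s := p.support.toFinset)
    (fun v => X v ≤ t)
  rw [List.toFinset_card_of_nodup hnd] at hsplit
  have h1 : (p.support.toFinset.filter fun v => X v ≤ t).card ≤ lowCount h ε t ω := by
    rw [hlow]
    exact Finset.card_le_card (Finset.filter_subset_filter _ (Finset.subset_univ _))
  have h2 : ((p.support.toFinset.filter fun v => ¬ X v ≤ t).card : ℝ) ≤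
      lfppLength h ξ ε ω p / (ε * exp (ξ * t)) := by
    rw [le_div_iff₀ (by positivity), lfppLength_eq, ← List.sum_toFinset _ hnd, ← nsmul_eq_mul,
      ← Finset.sum_const]
    refine (Finset.sum_le_sum fun v hv => ?_).trans
      (Finset.sum_le_sum_of_subset_of_nonneg (Finset.filter_subset _ _) fun v _ _ => by positivity)
    have hv' : t ≤ X v := (not_le.1 (Finset.mem_filter.1 hv).2).le
    have : ξ * t ≤ ξ * X v := mul_le_mul_of_nonneg_left hv' hξ
    gcongr
  have h3 : (numVertices p : ℝ) =
      ((p.support.toFinset.filter fun v => X v ≤ t).card : ℝ) +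
        ((p.support.toFinset.filter fun v => ¬ X v ≤ t).card : ℝ) := by
    rw [numVertices, ← hsplit]
    push_cast
    ring
  have h1' : ((p.support.toFinset.filter fun v => X v ≤ t).card : ℝ) ≤ lowCount h ε t ω := by
    exact_mod_cast h1
  linarith

section Prob

variable {Ω : Type*} [MeasurableSpace Ω] {P : Measure Ω} [IsProbabilityMeasure P]
  {h : Measure ℂ → Ω → ℝ} {ξ : ℝ}

/-- First moment estimate for the number of vertices where the field is at most
`-b log (1 / ε)`. -/
lemma IsWholePlaneGFF.measure_lowCount_gt_le (hh : IsWholePlaneGFF h P) {ε : ℝ} (hε : 0 < ε)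
    (hε1 : ε ≤ 1) (b : ℝ) {K : ℝ} (hK : 0 < K) :
    P {ω | ¬ (lowCount h ε (-(b * -Real.log ε)) ω : ℝ) ≤ K} ≤
      ENNReal.ofReal (4 / ε ^ 2 *
        exp (-(max b 0 * -Real.log ε) ^ 2 / (2 * (-Real.log ε + 4))) / K) := by
  classical
  have := finite_Box hε
  have := Fintype.ofFinite (Box ε)
  have hlog := Real.log_nonpos hε.le hε1
  set t := b * -Real.log ε with ht
  -- For `b < 0` the level is nonnegative and only the trivial bound `1 = exp 0` is used, hence the
  -- truncation of `b`.
  set c := exp (-(max b 0 * -Real.log ε) ^ 2 / (2 * (-Real.log ε + 4))) with hc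
  have hc0 : 0 < c := exp_pos _
  have hone : ∀ v : Box ε, P {ω | circleAvg h ε (toPlane ε v) ω ≤ -t} ≤ ENNReal.ofReal c := by
    intro v
    rcases le_total 0 b with hb | hb
    · rw [hc, max_eq_left hb]
      exact hh.measure_le_neg_le hε hε1 v (mul_nonneg hb (by linarith))
    · rw [hc, max_eq_right hb]
      simpa using prob_le_one
  set s : Box ε → Set Ω := fun v => {ω | circleAvg h ε (toPlane ε v) ω ≤ -t} with hs
  have hsm : ∀ v, NullMeasurableSet (s v) P := fun v =>
    nullMeasurableSet_le (hh.law_circleAvg _ hε).aemeasurable aemeasurable_const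
  set f : Ω → ENNReal := fun ω => ∑ v, (s v).indicator 1 ω with hf
  have hfm : ∀ v, AEMeasurable ((s v).indicator (1 : Ω → ENNReal)) P := fun v =>
    (aemeasurable_const (b := (1 : ENNReal))).indicator₀ (hsm v)
  have hcount : ∀ ω, f ω = (lowCount h ε (-t) ω : ENNReal) := by
    intro ω
    have hlow : lowCount h ε (-t) ω = (Finset.univ.filter fun v : Box ε => ω ∈ s v).card := by
      rw [lowCount, ← Set.ncard_coe_finset]
      congr 1
      ext v
      simp [hs]
    rw [hlow, hf]
    simp [Set.indicator_apply]
  have hint : ∫⁻ ω, f ω ∂P ≤ ENNReal.ofReal (4 / ε ^ 2 * c) := by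
    rw [hf, lintegral_finsetSum' _ fun v _ => hfm v]
    calc ∑ v, ∫⁻ ω, (s v).indicator 1 ω ∂P = ∑ v, P (s v) :=
          Finset.sum_congr rfl fun v _ => lintegral_indicator_one₀ (hsm v)
      _ ≤ ∑ _ : Box ε, ENNReal.ofReal c := Finset.sum_le_sum fun v _ => hone v
      _ = ENNReal.ofReal (Nat.card (Box ε) * c) := by
          rw [Finset.sum_const, Finset.card_univ, nsmul_eq_mul, Nat.card_eq_fintype_card,
            ENNReal.ofReal_mul (by positivity), ENNReal.ofReal_natCast]
      _ ≤ ENNReal.ofReal (4 / ε ^ 2 * c) :=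
          ENNReal.ofReal_le_ofReal (mul_le_mul_of_nonneg_right (card_Box_le hε hε1) hc0.le)
  have hK0 : ENNReal.ofReal K ≠ 0 := by simpa using hK
  have hmk := meas_ge_le_lintegral_div (μ := P) (f := f) (by
    rw [hf]
    exact Finset.aemeasurable_fun_sum _ fun v _ => hfm v) hK0 ENNReal.ofReal_ne_top
  refine (measure_mono fun ω hω => ?_).trans (hmk.trans ?_)
  · simp only [Set.mem_ofPred_eq, not_le] at hω ⊢
    rw [hcount, ← ENNReal.ofReal_natCast]
    exact ENNReal.ofReal_le_ofReal hω.le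
  · rw [ENNReal.ofReal_div_of_pos hK]
    gcongr

/-- The exponent for the number of vertices of a short path. -/
lemma sq_exponent {l : ℝ} (hl : -1 ≤ l) (ξ : ℝ) :
    0 ≤ √(2 + 2 * l + ξ ^ 2) - ξ ∧
      (√(2 + 2 * l + ξ ^ 2) - ξ) ^ 2 / 2 + ξ * (√(2 + 2 * l + ξ ^ 2) - ξ) = 1 + l := by
  have h1 : 0 ≤ 2 + 2 * l + ξ ^ 2 := by nlinarith
  have h2 := Real.sq_sqrt h1
  constructor
  · rw [sub_nonneg]
    exact Real.le_sqrt_of_sq_le (by linarith)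
  · nlinarith

/-- Short simple paths have few vertices. -/
theorem IsWholePlaneGFF.tendsto_numVertices_le (hh : IsWholePlaneGFF h P) (hξ : 0 < ξ)
    {l a ζ : ℝ} (ha : 0 ≤ a) (hal : a ^ 2 / 2 + ξ * a = 1 + l) (hζ : 0 < ζ) :
    ∃ b : ℝ → ℝ, Tendsto b (𝓝[>] 0) (𝓝 0) ∧ ∀ᶠ ε in 𝓝[>] (0 : ℝ),
      P {ω | ∀ (z w : Box ε) (p : (boxGraph ε).Walk z w), p.IsPath →
        lfppLength h ξ ε ω p ≤ ε ^ (l - ζ) →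
        (numVertices p : ℝ) ≤ ε ^ (l - ξ * a - 1 - ζ)}ᶜ ≤ ENNReal.ofReal (b ε) := by
  -- The level is moved from `-a L` to `-(a - η) L`. This gains a factor `ε ^ (ξ * η)` for the high
  -- vertices, absorbing a constant `2`, and costs the low ones at most `ζ / 2` in the exponent.
  set η : ℝ := ζ / (2 * (a + 1)) with hη
  have hη0 : 0 < η := by positivity
  have haη : 2 * (a * η) ≤ ζ := by
    rw [hη, ← mul_div_assoc, ← mul_div_assoc, div_le_iff₀ (by positivity)]
    nlinarith
  set m := max (a - η) 0 with hm
  have hm0 : 0 ≤ m := le_max_right _ _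
  have hma : a ^ 2 - m ^ 2 ≤ ζ := by
    rcases le_total 0 (a - η) with h0 | h0
    · rw [hm, max_eq_left h0]; nlinarith
    · rw [hm, max_eq_right h0]; nlinarith
  set E := l - ξ * a - 1 - ζ with hE
  refine ⟨fun ε => 8 * exp (2 * m ^ 2) * ε ^ (ζ / 2), ?_, ?_⟩
  · simpa using (tendsto_rpow_nhdsGT_zero (half_pos hζ)).const_mul (8 * exp (2 * m ^ 2))
  filter_upwards [eventually_mem_Ioc, eventually_const_mul_rpow_le 2 (mul_pos hξ hη0)]
    with ε ⟨hε, hε1⟩ h2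
  have hlog := Real.log_nonpos hε.le hε1
  set L := -Real.log ε with hL
  have hL0 : 0 ≤ L := by linarith
  have hεL : ε = exp (-L) := by rw [hL, neg_neg, Real.exp_log hε]
  have hEpos : 0 < ε ^ E := Real.rpow_pos_of_pos hε _
  have hb := hh.measure_lowCount_gt_le hε hε1 (a - η) (half_pos hEpos)
  rw [← hL, ← hm] at hb
  refine (measure_mono ?_).trans (hb.trans (ENNReal.ofReal_le_ofReal ?_))
  · intro ω hω hlow
    refine hω fun z w p hp hlen => ?_
    have h3 := numVertices_le (h := h) (ω := ω) hε hξ.le (-((a - η) * L)) hp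
    have h4 : lfppLength h ξ ε ω p / (ε * exp (ξ * -((a - η) * L))) ≤ ε ^ E / 2 := by
      rw [div_le_iff₀ (by positivity)]
      refine hlen.trans ?_
      have e1 : ε * exp (ξ * -((a - η) * L)) = ε ^ (1 + ξ * (a - η)) := by
        rw [rpow_eq_exp_neg_log hε, ← hL]
        nth_rewrite 1 [hεL]
        rw [← Real.exp_add]
        congr 1; ring
      have e2 : ε ^ (l - ζ) = ε ^ E * ε ^ (1 + ξ * (a - η)) * ε ^ (ξ * η) := by
        rw [← Real.rpow_add hε, ← Real.rpow_add hε, hE]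
        congr 1; ring
      rw [e1, e2]
      have : 0 < ε ^ E * ε ^ (1 + ξ * (a - η)) := by positivity
      nlinarith
    linarith
  -- The quadratic equation for `a` enters here: the low-vertex exponent becomes `(a² - m²) / 2 -
  -- ζ`, at most `-ζ / 2`.
  · have hEa : 2 + E = a ^ 2 / 2 - ζ := by rw [hE]; linarith
    -- Uses `L² / (L + 4) ≥ L - 4`: the bounded excess in the variance costs only the constant `exp
    -- (2 * m ^ 2)`.
    have e1 : exp (-(m * L) ^ 2 / (2 * (L + 4))) ≤ exp (2 * m ^ 2 - m ^ 2 / 2 * L) := by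
      rw [Real.exp_le_exp, div_le_iff₀ (by linarith)]
      nlinarith [mul_nonneg hL0 (sq_nonneg m), sq_nonneg m]
    have e2 : 4 / ε ^ 2 * exp (-(m * L) ^ 2 / (2 * (L + 4))) / (ε ^ E / 2) =
        8 * (exp (2 * L) * exp (-(m * L) ^ 2 / (2 * (L + 4))) * exp (E * L)) := by
      have h5 : ε ^ E = (exp (E * L))⁻¹ := by
        rw [rpow_eq_exp_neg_log hε, ← hL, ← Real.exp_neg]
        congr 1; ring
      have h6 : ε ^ 2 = (exp (2 * L))⁻¹ := by
        rw [hεL, ← Real.exp_nat_mul, ← Real.exp_neg]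
        congr 1; push_cast; ring
      rw [h5, h6]
      field_simp
      norm_num
    change _ ≤ 8 * exp (2 * m ^ 2) * ε ^ (ζ / 2)
    rw [e2, mul_assoc 8 (exp (2 * m ^ 2))]
    refine mul_le_mul_of_nonneg_left ?_ (by norm_num)
    calc exp (2 * L) * exp (-(m * L) ^ 2 / (2 * (L + 4))) * exp (E * L)
        ≤ exp (2 * L) * exp (2 * m ^ 2 - m ^ 2 / 2 * L) * exp (E * L) := by gcongr
      _ = exp (2 * m ^ 2) * exp ((2 + E - m ^ 2 / 2) * L) := by
          rw [← Real.exp_add, ← Real.exp_add, ← Real.exp_add]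
          congr 1; ring
      _ ≤ exp (2 * m ^ 2) * ε ^ (ζ / 2) := by
          refine mul_le_mul_of_nonneg_left ?_ (exp_pos _).le
          rw [rpow_eq_exp_neg_log hε, ← hL, Real.exp_le_exp]
          refine mul_le_mul_of_nonneg_right ?_ hL0
          rw [hEa]
          linarith

end Prob

end LFPP

end

/-! ### The vertex bound and the geodesic dimension -/

theorem corollary2p7 {Ω : Type*} [MeasurableSpace Ω] (P : Measure Ω) [IsProbabilityMeasure P]
    (h : Measure ℂ → Ω → ℝ) (hh : LFPP.IsWholePlaneGFF h P) (ξ : ℝ) (hξ : 0 < ξ) :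
    (∀ ζ : ℝ, 0 < ζ →
      Tendsto (fun ε : ℝ => P {ω | ∀ (z w : LFPP.Box ε) (p : (LFPP.boxGraph ε).Walk z w),
          p.IsPath →
          LFPP.lfppLength h ξ ε ω p ≤ ε ^ (LFPP.distExponent h P ξ - ζ) →
          (LFPP.numVertices p : ℝ) ≤
            ε ^ (LFPP.distExponent h P ξ
              - ξ * (√(2 + 2 * LFPP.distExponent h P ξ + ξ ^ 2) - ξ) - 1 - ζ)})
        (𝓝[>] 0) (𝓝 1)) ∧
    LFPP.geodesicDim h P ξ ≤
      1 - LFPP.distExponent h P ξ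
        + ξ * (√(2 + 2 * LFPP.distExponent h P ξ + ξ ^ 2) - ξ) := by
  classical
  obtain ⟨ha, hal⟩ := LFPP.sq_exponent (hh.neg_one_le_distExponent hξ) ξ
  set l := LFPP.distExponent h P ξ with hl
  set a := √(2 + 2 * l + ξ ^ 2) - ξ with ha'
  have hdist : ∀ ζ : ℝ, 0 < ζ → Tendsto
      (fun ε => P {ω | LFPP.crossingDist h ξ ε ω ≤ ε ^ (l - ζ)}) (𝓝[>] 0) (𝓝 1) :=
    fun ζ hζ => hh.tendsto_crossingDist_le_distExponent hξ hζ
  refine ⟨fun ζ hζ => ?_, ?_⟩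
  · obtain ⟨b, hb, hle⟩ := hh.tendsto_numVertices_le hξ ha hal hζ
    exact LFPP.tendsto_measure_one_of_compl_le hle hb
  -- Exponents admitted in `geodesicDim` must be positive. A negative value here would give, with
  -- positive probability, a short simple path with fewer than one vertex.
  have hnonneg : ∀ ζ : ℝ, 0 < ζ → 0 ≤ 1 - l + ξ * a + ζ := by
    intro ζ hζ
    obtain ⟨b, hb, hle⟩ := hh.tendsto_numVertices_le hξ ha hal hζ
    have ht := LFPP.tendsto_measure_one_of_inter_compl_le (F := fun ε => {ω |
      LFPP.crossingDist h ξ ε ω ≤ ε ^ (l - ζ / 2)} ∩ _) (hdist (ζ / 2) (half_pos hζ)) hle hb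
      (Eventually.of_forall fun ε => subset_rfl)
    have hpos := ht.eventually (lt_mem_nhds one_pos)
    have hlt : ∀ᶠ ε : ℝ in 𝓝[>] 0, ε < 1 := by
      filter_upwards [Ioo_mem_nhdsGT (zero_lt_one' ℝ)] with ε hε using hε.2
    obtain ⟨ε, hεP, ⟨hε, -⟩, hε1⟩ := (hpos.and (LFPP.eventually_mem_Ioc.and hlt)).exists
    obtain ⟨ω, hω1, hω2⟩ := nonempty_of_measure_ne_zero hεP.ne'
    have hω1' : LFPP.crossingDist h ξ ε ω ≤ ε ^ (l - ζ / 2) := hω1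
    have hlt' : LFPP.crossingDist h ξ ε ω < ε ^ (l - ζ) :=
      hω1'.trans_lt (Real.rpow_lt_rpow_of_exponent_gt hε hε1 (by linarith))
    obtain ⟨z, w, p, hp⟩ := LFPP.exists_walk_of_crossingDist_lt hε hlt'
    have h1 := hω2 z w p.bypass p.bypass_isPath ((LFPP.lfppLength_bypass_le hε p).trans hp.le)
    have h2 : (1 : ℝ) ≤ LFPP.numVertices p.bypass := by exact_mod_cast LFPP.numVertices_pos _
    by_contra hcon
    have h3 : ε ^ (l - ξ * a - 1 - ζ) < 1 := Real.rpow_lt_one hε.le hε1 (by linarith)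
    linarith
  have hnonneg' : 0 ≤ 1 - l + ξ * a := le_of_forall_pos_le_add fun ζ hζ => hnonneg ζ hζ
  refine le_of_forall_pos_le_add fun ζ hζ => ?_
  refine csInf_le ⟨0, fun α hα => hα.1.le⟩ ⟨by linarith, ?_⟩
  obtain ⟨b, hb, hle⟩ := hh.tendsto_numVertices_le hξ ha hal hζ
  -- A geodesic is simple and has length equal to the crossing distance, so the vertex bound applies
  -- to it on the intersection of the two events.
  refine (LFPP.tendsto_measure_one_of_inter_compl_le (hdist ζ hζ) hle hb ?_).liminf_eq
  filter_upwards [LFPP.eventually_mem_Ioc] with ε ⟨hε, _⟩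
  rintro ω ⟨hω1, hω2⟩ z w p hp
  have h1 := hω2 z w p (hp.isPath hε) (hp.2.2.trans_le hω1)
  refine h1.trans (le_of_eq ?_)
  congr 1
  ring
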